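/- Let $k$ be an algebraically closed field and let $X=X_1\cup X_2\cup X_3$ be a proper reduced curve over $k$ whose components are smooth integral curves, where $X_1$ and $X_2$ meet transversally at a single point $A$, $X_2$ and $X_3$ meet transversally at a single point $B$, and $X_1\cap X_3=\emptyset$ (so $A\ne B$). For $q=1,2,3$ let $X_q^c$ be the union of the other two components, and let $e_1=(-1,1,0)$, $e_2=(1,-2,1)$, $e_3=(0,1,-1)$. Fix integers $d,r\ge 0$. Multidegrees are triples $\underline d=(i,d-i-l,l)$ with $i,l\ge 0$ and $i+l\le d$. For each multidegree $\underline d$ let $\mathcal L_{\underline d}$ be an invertible sheaf on $X$ of multidegree $\underline d$, and whenever $\underline d$ and $\underline{\tilde d}=\underline d+e_q$ are both multidegrees let $\varphi_{\underline d,\underline{\tilde d}}:\mathcal L_{\underline d}\to\mathcal L_{\underline{\tilde d}}$ and $\varphi_{\underline{\tilde d},\underline d}:\mathcal L_{\underline{\tilde d}}\to\mathcal L_{\underline d}$ be morphisms which factor, respectively, as $$\mathcal L_{\underline d}\to\mathcal L_{\underline d}|_{X_q^c}\cong\mathcal L_{\underline{\tilde d}}|_{X_q^c}(-X_q\cap X_q^c)\hookrightarrow\mathcal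 L_{\underline{\tilde d}},\qquad \mathcal L_{\underline{\tilde d}}\to\mathcal L_{\underline{\tilde d}}|_{X_q}\cong\mathcal L_{\underline d}|_{X_q}(-X_q\cap X_q^c)\hookrightarrow\mathcal L_{\underline d}$$ (restriction, an isomorphism, natural inclusion), such that $\varphi_{\underline d^2,\underline d^3}\circ\varphi_{\underline d^1,\underline d^2}=\varphi_{\underline d^1,\underline d^3}$ whenever $\underline d^2=\underline d^1+e_p$ and $\underline d^3=\underline d^2+e_q$ with $p\neq q$. A limit linear series of degree $d$ and dimension $r$ consists of such data and of subspaces $V_{\underline d}\subseteq H^0(X,\mathcal L_{\underline d})$ of dimension $r+1$ that are carried into one another by all these maps $\varphi$. For a union $Y$ of components, $V_{\underline d}^{Y,0}$ is the subspace of the sections in $V_{\underline d}$ that vanish on $Y$. The series is exact if $\varphi_{\underline d,\underline{\tilde d}}(V_{\underline d})=V_{\underline{\tilde d}}^{X_q,0}$ and $\varphi_{\underline{\tilde d},\underline d}(V_{\underline{\tilde d}})=V_{\underline d}^{X_q^c,0}$ for all such $q,\underline d,\underline{\tilde d}$. Distributivity holds in $V_{\underline d}$ if $V_{\underline d}^{X_1,0}\cap(V_{\underline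 d}^{X_2,0}+V_{\underline d}^{X_3,0})=V_{\underline d}^{X_1,0}\cap V_{\underline d}^{X_2,0}+V_{\underline d}^{X_1,0}\cap V_{\underline d}^{X_3,0}$. **Proposition.** Suppose that the limit linear series is exact and that distributivity holds in $V_{\underline d}$ for every $\underline d$. For $\underline d=(i,d-i-l,l)$ write $$\underline d'=(i-1,d-i-l+2,l-1),\qquad \underline d''=(i-1,d-i-l+1,l),\qquad \underline d'''=(i,d-i-l-1,l+1).$$ Then, for each $q=1,2,3$, there are subspaces $W^q_{\underline d}\subseteq V_{\underline d}$ with $V_{\underline d}=W^q_{\underline d}\oplus V_{\underline d}^{X_q,0}$ and bases $\beta^q_{\underline d}$ of $W^q_{\underline d}$, for all $\underline d$, such that the following hold, where each inclusion is for all $i,l$ for which both multidegrees in it are nonnegative (that is, $i,l\ge1$ and $i+l\le d$ for $\underline d'$; $i\ge1$, $l\ge 0$ and $i+l\le d$ for $\underline d''$; $i,l\ge 0$ and $i+l\le d-1$ for $\underline d'''$): 1. for $q=1$: $\varphi_{\underline d''',\underline d}(\beta^1_{\underline d'''})\subseteq\beta^1_{\underline d}$, $\varphi_{\underline d',\underline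 d}(\beta^1_{\underline d'})\subseteq\beta^1_{\underline d}$ and $\varphi_{\underline d'',\underline d}(\beta^1_{\underline d''})\subseteq\beta^1_{\underline d}$; 2. for $q=2$: $\varphi_{\underline d''',\underline d}(\beta^2_{\underline d'''})\subseteq\beta^2_{\underline d}$, $\varphi_{\underline d,\underline d''}(\beta^2_{\underline d})\subseteq\beta^2_{\underline d''}$ and $\varphi_{\underline d,\underline d'}(\beta^2_{\underline d})\subseteq\beta^2_{\underline d'}$; 3. for $q=3$: $\varphi_{\underline d,\underline d''}(\beta^3_{\underline d})\subseteq\beta^3_{\underline d''}$, $\varphi_{\underline d',\underline d}(\beta^3_{\underline d'})\subseteq\beta^3_{\underline d}$ and $\varphi_{\underline d,\underline d'''}(\beta^3_{\underline d})\subseteq\beta^3_{\underline d'''}$. -/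

import Mathlib

open CategoryTheory CategoryTheory.Limits AlgebraicGeometry TopologicalSpace Opposite

universe u

noncomputable section

namespace LimitLinear

/-! ### Restriction of sheaves of modules to closed subsets; invertible sheaves -/

section Sheaves

variable {X : Scheme.{u}}

/-- A closed subset of `X` as a closed subscheme, with its reduced structure. -/
abbrev reduced (Y : Closeds X) : Scheme.{u} :=
  (Scheme.IdealSheafData.vanishingIdeal Y).subscheme

/-- The closed immersion of a closed subset with its reduced structure. -/
abbrev incl (Y : Closeds X) : reduced Y ⟶ X :=
  (Scheme.IdealSheafData.vanishingIdeal Y).subschemeι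

/-- The restriction `L|_Y`, as a sheaf on `Y`. -/
def restrictTo (Y : Closeds X) (L : X.Modules) : (reduced Y).Modules :=
  (Scheme.Modules.pullback (incl Y)).obj L

/-- The restriction `L|_Y`, regarded as a sheaf on `X` (extension by zero). -/
def restrictSheaf (Y : Closeds X) (L : X.Modules) : X.Modules :=
  (Scheme.Modules.pushforward (incl Y)).obj (restrictTo Y L)

/-- The restriction map `L ⟶ L|_Y`. -/
def restrictMap (Y : Closeds X) (L : X.Modules) : L ⟶ restrictSheaf Y L :=
  (Scheme.Modules.pullbackPushforwardAdjunction (incl Y)).unit.app L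

/-- For `Y` and `Z` complementary unions of components of `X`, the morphism `φ : L ⟶ M` factors as
`L ⟶ L|_Y ≅ M|_Y(-Y ∩ Z) ↪ M`: restriction, an isomorphism, and the natural inclusion.
Here `M|_Y(-Y ∩ Z)` is regarded as a subsheaf of `M` through the exact sequence
`0 ⟶ M|_Y(-Y ∩ Z) ⟶ M ⟶ M|_Z ⟶ 0`, that is, as the kernel of the restriction to `Z`. -/
def FactorsThrough {L M : X.Modules} (φ : L ⟶ M) (Y Z : Closeds X) : Prop :=
  ∃ e : restrictSheaf Y L ≅ kernel (restrictMap Z M),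
    φ = restrictMap Y L ≫ e.hom ≫ kernel.ι (restrictMap Z M)

/-- The section `e` freely generates `M` over `U`. -/
def IsFrame (M : X.Modules) (U : X.Opens) (e : Γ(M, U)) : Prop :=
  ∀ (V : X.Opens) (h : V ≤ U) (t : Γ(M, V)),
    ∃! f : Γ(X, V), t = f • M.presheaf.map (homOfLE h).op e

/-- Invertible sheaves: locally free of rank one. -/
def IsInvertible (M : X.Modules) : Prop :=
  ∀ x : X, ∃ U : X.Opens, x ∈ U ∧ ∃ e : Γ(M, U), IsFrame M U e

end Sheaves

/-! ### Degree of an invertible sheaf on a curve -/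

section Degree

variable {C : Scheme.{u}} [IsIntegral C] [IsLocallyNoetherian C]

/-- The rational section of the invertible sheaf `M` given by `s ∈ Γ(M, U)` has order `n` at `x`:
if `e` generates `M` near `x` and `s = f e`, then `f` has order `n` at `x`. -/
def HasOrderAt (M : C.Modules) {U : C.Opens} (s : Γ(M, U)) (x : C) (n : ℤ) : Prop :=
  ∃ (W : C.Opens) (e : Γ(M, W)) (f : Γ(C, U ⊓ W)) (_ : Nonempty (U ⊓ W : C.Opens)),
    x ∈ W ∧ IsFrame M W e ∧
    M.presheaf.map (homOfLE inf_le_left).op s =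
      f • M.presheaf.map (homOfLE inf_le_right).op e ∧
    Scheme.ord (C.germToFunctionField (U ⊓ W) f) x = n

/-- The invertible sheaf `M`, on a proper regular integral curve over an algebraically closed field,
has degree `n`: every nonzero rational section of `M` has a divisor, and it is of degree `n`. -/
def HasDegree (M : C.Modules) (n : ℤ) : Prop :=
  ∀ (U : C.Opens) (s : Γ(M, U)), s ≠ 0 →
    ∃ D : C →₀ ℤ, (∀ x, HasOrderAt M s x (D x)) ∧ (D.sum fun _ m ↦ m) = n

end Degree

/-! ### Curves of compact type with three components in a chain -/

/-- A proper reduced curve `X` over `k`, the union of three smooth (integral) curves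
`X₁, X₂, X₃` (indexed here by `0, 1, 2`), where `X₁` and `X₂` meet transversally in the single
point `A`, `X₂` and `X₃` meet transversally in the single point `B`, and `X₁`, `X₃` are disjoint
(in particular `A ≠ B`). Transversality: the scheme-theoretic intersection is a reduced point. -/
structure ThreeComponentCurve (k : Type u) [Field k] where
  X : Scheme.{u}
  toSpec : X ⟶ Spec (CommRingCat.of k)
  [isReduced : IsReduced X]
  [isProper : IsProper toSpec]
  component : Fin 3 → Closeds X
  [isIntegral : ∀ q, IsIntegral (reduced (component q))]
  [smooth : ∀ q, Smooth (incl (component q) ≫ toSpec)]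
  dim_eq_one : ∀ q, topologicalKrullDim (reduced (component q)) = 1
  union : ⨆ q, component q = ⊤
  A : X
  B : X
  isClosed_A : IsClosed {A}
  isClosed_B : IsClosed {B}
  meet_A : Scheme.IdealSheafData.vanishingIdeal (component 0) ⊔
      Scheme.IdealSheafData.vanishingIdeal (component 1) =
    Scheme.IdealSheafData.vanishingIdeal ⟨{A}, isClosed_A⟩
  meet_B : Scheme.IdealSheafData.vanishingIdeal (component 1) ⊔
      Scheme.IdealSheafData.vanishingIdeal (component 2) =
    Scheme.IdealSheafData.vanishingIdeal ⟨{B}, isClosed_B⟩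
  disjoint : component 0 ⊓ component 2 = ⊥

namespace ThreeComponentCurve

variable {k : Type u} [Field k] (C : ThreeComponentCurve k)

instance : IsReduced C.X := C.isReduced
instance : IsProper C.toSpec := C.isProper
instance (q : Fin 3) : IsIntegral (reduced (C.component q)) := C.isIntegral q
instance (q : Fin 3) : Smooth (incl (C.component q) ≫ C.toSpec) := C.smooth q

instance (q : Fin 3) : IsLocallyNoetherian (reduced (C.component q)) :=
  LocallyOfFiniteType.isLocallyNoetherian (incl (C.component q) ≫ C.toSpec)

/-- `X_q^c`, the union of the two components other than `X_q`. -/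
def compl (q : Fin 3) : Closeds C.X := ⨆ (p : Fin 3) (_ : p ≠ q), C.component p

/-- The structure map `k → Γ(X, 𝒪_X)`. -/
def scalars : k →+* Γ(C.X, ⊤) :=
  C.toSpec.appTop.hom.comp (Scheme.ΓSpecIso (CommRingCat.of k)).inv.hom

/-- `H⁰(X, L)`. -/
def H0 (L : C.X.Modules) : Type u := Γ(L, ⊤)

instance (L : C.X.Modules) : AddCommGroup (C.H0 L) := inferInstanceAs (AddCommGroup Γ(L, ⊤))

instance (L : C.X.Modules) : Module Γ(C.X, ⊤) (C.H0 L) :=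
  inferInstanceAs (Module Γ(C.X, ⊤) Γ(L, ⊤))

instance (L : C.X.Modules) : Module k (C.H0 L) := Module.compHom (C.H0 L) C.scalars

/-- The `k`-linear map on global sections induced by a morphism of sheaves of modules. -/
def mapH0 {L M : C.X.Modules} (φ : L ⟶ M) : C.H0 L →ₗ[k] C.H0 M where
  toFun s := (φ.app ⊤).hom s
  map_add' s t := map_add (φ.app ⊤).hom s t
  map_smul' c s := φ.app_smul (C.scalars c) s

/-- The global sections of `L` that vanish on `Y`. -/
def vanishing (L : C.X.Modules) (Y : Closeds C.X) : Submodule k (C.H0 L) :=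
  LinearMap.ker (C.mapH0 (restrictMap Y L))

end ThreeComponentCurve

/-! ### Multidegrees -/

/-- The nonnegative multidegree `(i, d - i - l, l)` of total degree `d`. -/
@[ext]
structure Multidegree (d : ℕ) where
  i : ℕ
  l : ℕ
  le : i + l ≤ d

/-- The three components `i`, `d - i - l`, `l` of a multidegree. -/
def Multidegree.deg {d : ℕ} (a : Multidegree d) : Fin 3 → ℤ :=
  ![(a.i : ℤ), (d : ℤ) - (a.i : ℤ) - (a.l : ℤ), (a.l : ℤ)]

/-- The multidegree of the twisting sheaf `𝒪_(X_q)`, where `𝒪_(X₁)` restricts to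
`𝒪(-A), 𝒪(A), 𝒪`, `𝒪_(X₂)` to `𝒪(A), 𝒪(-A-B), 𝒪(B)` and `𝒪_(X₃)` to `𝒪, 𝒪(B), 𝒪(-B)` on
`X₁, X₂, X₃`. -/
def twist : Fin 3 → Fin 3 → ℤ := ![![-1, 1, 0], ![1, -2, 1], ![0, 1, -1]]

/-- `b` is the multidegree `a` increased by the multidegree of `𝒪_(X_q)`. -/
def Step {d : ℕ} (q : Fin 3) (a b : Multidegree d) : Prop :=
  ∀ j, b.deg j = a.deg j + twist q j

/-! ### Limit linear series -/

section LimitLinearSeries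

variable {k : Type u} [Field k]

/-- The sheaves `L_a` of a limit linear series, one for each multidegree `a ≥ 0` of total degree
`d`, with the maps `φ a b` linking those whose multidegrees differ by that of some `𝒪_(X_q)`; the
morphisms `φ a b` for other pairs are irrelevant. The factorizations determine the restrictions of
each `L_a` to the components from those of the sheaf `L` of multidegree `(d, 0, 0)`: for
`a = (i, d - i - l, l)` these are `L|_{X₁}(-(d-i)A)`, `L|_{X₂}((d-i)A - lB)` and `L|_{X₃}(lB)`. -/
structure LinkedSheaves (C : ThreeComponentCurve k) (d : ℕ) where
  L : Multidegree d → C.X.Modules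
  invertible : ∀ a, IsInvertible (L a)
  multidegree : ∀ a q, HasDegree (restrictTo (C.component q) (L a)) (a.deg q)
  φ : ∀ a b, L a ⟶ L b
  factors_up : ∀ q a b, Step q a b → FactorsThrough (φ a b) (C.compl q) (C.component q)
  factors_down : ∀ q a b, Step q a b → FactorsThrough (φ b a) (C.component q) (C.compl q)
  comp : ∀ p q a b c, p ≠ q → Step p a b → Step q b c → φ a b ≫ φ b c = φ a c

/-- A limit linear series of degree `d` and dimension `r` on `C`. -/
structure LimitLinearSeries (C : ThreeComponentCurve k) (d r : ℕ) extends LinkedSheaves C d where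
  V : ∀ a, Submodule k (C.H0 (L a))
  finrank_V : ∀ a, Module.finrank k (V a) = r + 1
  linked_up : ∀ q a b, Step q a b → (V a).map (C.mapH0 (φ a b)) ≤ V b
  linked_down : ∀ q a b, Step q a b → (V b).map (C.mapH0 (φ b a)) ≤ V a

namespace LimitLinearSeries

variable {C : ThreeComponentCurve k} {d r : ℕ} (g : LimitLinearSeries C d r)

/-- `V_a^{Y,0}`, the sections in `V_a` that vanish on `Y`. -/
def Vvan (a : Multidegree d) (Y : Closeds C.X) : Submodule k (C.H0 (g.L a)) :=
  g.V a ⊓ C.vanishing (g.L a) Y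

/-- The linking map `H⁰(L_a) → H⁰(L_b)`. -/
def link (a b : Multidegree d) : C.H0 (g.L a) →ₗ[k] C.H0 (g.L b) := C.mapH0 (g.φ a b)

/-- Exact limit linear series. -/
def IsExact : Prop :=
  ∀ q a b, Step q a b →
    (g.V a).map (g.link a b) = g.Vvan b (C.component q) ∧
    (g.V b).map (g.link b a) = g.Vvan a (C.compl q)

/-- Distributivity in `V_a`: `V_a^{X₁,0}` distributes over `V_a^{X₂,0}` and `V_a^{X₃,0}`. -/
def Distributive (a : Multidegree d) : Prop :=
  g.Vvan a (C.component 0) ⊓ (g.Vvan a (C.component 1) ⊔ g.Vvan a (C.component 2)) =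
    (g.Vvan a (C.component 0) ⊓ g.Vvan a (C.component 1)) ⊔
      (g.Vvan a (C.component 0) ⊓ g.Vvan a (C.component 2))

/-- For every multidegree `a`, `β a` is a basis of the subspace `W a` of `V_a`, and
`V_a = W a ⊕ V_a^{X_q,0}`. -/
def IsComplementBasis (q : Fin 3) (W : ∀ a, Submodule k (C.H0 (g.L a)))
    (β : ∀ a, Set (C.H0 (g.L a))) : Prop :=
  ∀ a, LinearIndepOn k id (β a) ∧ Submodule.span k (β a) = W a ∧
    W a ⊔ g.Vvan a (C.component q) = g.V a ∧ Disjoint (W a) (g.Vvan a (C.component q))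

end LimitLinearSeries

end LimitLinearSeries

end LimitLinear

end

/-! Fix `q`. Modulo the sections vanishing on `X_q`, a section in `V_a` is its restriction to `X_q`,
and a link that begins by restricting to a union of components containing `X_q` is injective on
these quotients (`mem_vanishing_of_mapH0`). Such links are the steps `e_p` with `p ≠ q` and the
reversed steps `e_q`. They form no cycle, so lifts of bases can be chosen by recursion along them
(`exists_linked_bases`): at `a`, extend the images of the bases already chosen. The point is that
these images are together independent modulo `V_a^{X_q,0}`.

Let `b`, `c` lead to `a` by the steps `e_p`, `e_{p'}`, and let `e` be `a` shifted by `e_q`. As `e_1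
+ e_2 + e_3 = 0`, the link from `e` to `a` factors through both `b` and `c`. By exactness the images
from `b`, `c`, `e` are `V_a^{X_p,0}`, `V_a^{X_{p'},0}` and their intersection. Distributivity and
the modular law (`Distributive.sup_inf_sup_le`) show that, modulo `V_a^{X_q,0}`, the images from `b`
and `c` meet in the image from `e`. The two image families share the image of the basis at `e`, so
their union is independent (`linearIndepOn_union_of_inf_le`).

On the edge of the triangle of multidegrees some of `b`, `c`, `e` are missing. If `b` or `c` is,
then either no arrow reaches `a` or all factor through one of them. If only `e` is, then `X_q = X_2`
and the degree on `X_2` is below two; a section vanishing on `X_1` and `X_3` then has too many zeros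
on `X_2`, at `A` and `B`, and is zero (`eq_zero_of_mem_vanishing`). -/

noncomputable section

namespace LimitLinear

/-! ### Coordinates in a frame and vanishing at a point -/

section Frames

variable {X Y : Scheme.{u}} {M : X.Modules}

lemma IsFrame.restrict {U U' : X.Opens} {e : Γ(M, U)} (he : IsFrame M U e) (h : U' ≤ U) :
    IsFrame M U' (M.presheaf.map (homOfLE h).op e) := by
  intro V hV t
  have := he V (hV.trans h) t
  rwa [← ConcreteCategory.comp_apply, ← Functor.map_comp]

/-- The coordinate of a section with respect to a frame. -/
def IsFrame.coord {U V : X.Opens} {e : Γ(M, U)} (he : IsFrame M U e) (h : V ≤ U) (t : Γ(M, V)) :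
    Γ(X, V) :=
  (he V h t).choose

lemma IsFrame.coord_smul {U V : X.Opens} {e : Γ(M, U)} (he : IsFrame M U e) (h : V ≤ U)
    (t : Γ(M, V)) : t = he.coord h t • M.presheaf.map (homOfLE h).op e :=
  (he V h t).choose_spec.1

lemma IsFrame.coord_eq {U V : X.Opens} {e : Γ(M, U)} (he : IsFrame M U e) (h : V ≤ U)
    {t : Γ(M, V)} {f : Γ(X, V)} (hf : t = f • M.presheaf.map (homOfLE h).op e) :
    he.coord h t = f :=
  ((he V h t).choose_spec.2 f hf).symm

lemma IsFrame.coord_res {U V V' : X.Opens} {e : Γ(M, U)} (he : IsFrame M U e) (h : V ≤ U)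
    (h' : V' ≤ V) (t : Γ(M, V)) :
    he.coord (h'.trans h) (M.presheaf.map (homOfLE h').op t) =
      X.presheaf.map (homOfLE h').op (he.coord h t) := by
  apply he.coord_eq
  conv_lhs => rw [he.coord_smul h t]
  rw [Scheme.Modules.map_smul, ← ConcreteCategory.comp_apply (M.presheaf.map _), ← Functor.map_comp]
  rfl


lemma IsFrame.coord_add {U V : X.Opens} {e : Γ(M, U)} (he : IsFrame M U e) (h : V ≤ U)
    (s t : Γ(M, V)) : he.coord h (s + t) = he.coord h s + he.coord h t := by
  apply he.coord_eq
  rw [add_smul, ← he.coord_smul, ← he.coord_smul]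

lemma IsFrame.coord_smul_left {U V : X.Opens} {e : Γ(M, U)} (he : IsFrame M U e) (h : V ≤ U)
    (r : Γ(X, V)) (t : Γ(M, V)) : he.coord h (r • t) = r * he.coord h t := by
  apply he.coord_eq
  rw [mul_smul, ← he.coord_smul]

section Eval

variable {T : Scheme.{u}} (q : T ⟶ X) {U : X.Opens} {e : Γ(M, U)}

/-- The coordinates of the sections of `M` over `V ⊓ U`, pulled back along a morphism `q : T ⟶ X`
with image in `U`. -/
def IsFrame.eval (he : IsFrame M U e) (V : X.Opens) (h : q ⁻¹ᵁ V ≤ q ⁻¹ᵁ (V ⊓ U)) :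
    Γ(M, V) →+ Γ(T, q ⁻¹ᵁ V) :=
  AddMonoidHom.mk' (fun s ↦ q.appLE (V ⊓ U) (q ⁻¹ᵁ V) h
    (he.coord inf_le_right (M.presheaf.map (homOfLE inf_le_left).op s)))
    (fun s t ↦ by rw [map_add, he.coord_add, map_add])

lemma IsFrame.eval_apply (he : IsFrame M U e) (V : X.Opens) (h : q ⁻¹ᵁ V ≤ q ⁻¹ᵁ (V ⊓ U))
    (s : Γ(M, V)) : he.eval q V h s = q.appLE (V ⊓ U) (q ⁻¹ᵁ V) h
      (he.coord inf_le_right (M.presheaf.map (homOfLE inf_le_left).op s)) := rfl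

lemma IsFrame.eval_map (he : IsFrame M U e) {V W : X.Opens} (i : W ⟶ V)
    (hV : q ⁻¹ᵁ V ≤ q ⁻¹ᵁ (V ⊓ U)) (hW : q ⁻¹ᵁ W ≤ q ⁻¹ᵁ (W ⊓ U)) (s : Γ(M, V)) :
    he.eval q W hW (M.presheaf.map i.op s) =
      T.presheaf.map ((Opens.map q.base).map i).op (he.eval q V hV s) := by
  rw [eval_apply, eval_apply]
  have h : W ⊓ U ≤ V ⊓ U := inf_le_inf_right U i.le
  have h1 : M.presheaf.map (homOfLE inf_le_left).op (M.presheaf.map i.op s) =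
      M.presheaf.map (homOfLE h).op (M.presheaf.map (homOfLE inf_le_left).op s) := by
    rw [← ConcreteCategory.comp_apply, ← ConcreteCategory.comp_apply, ← Functor.map_comp,
      ← Functor.map_comp]
    rfl
  rw [h1, he.coord_res inf_le_right h, ← ConcreteCategory.comp_apply,
    ← ConcreteCategory.comp_apply, Scheme.Hom.map_appLE, Scheme.Hom.appLE_map]

lemma IsFrame.eval_smul (he : IsFrame M U e) (V : X.Opens) (h : q ⁻¹ᵁ V ≤ q ⁻¹ᵁ (V ⊓ U))
    (r : Γ(X, V)) (s : Γ(M, V)) : he.eval q V h (r • s) = q.app V r * he.eval q V h s := by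
  rw [eval_apply, eval_apply, Scheme.Modules.map_smul, he.coord_smul_left, map_mul,
    ← ConcreteCategory.comp_apply, Scheme.Hom.map_appLE, Scheme.Hom.app_eq_appLE]

/-- A frame of `M` over `U` and a morphism `q : T ⟶ X` with image in `U` give a morphism from `M`
to the pushforward of the structure sheaf of `T`, evaluating coordinates. -/
def IsFrame.evalHom (he : IsFrame M U e) (hq : ∀ V : X.Opens, q ⁻¹ᵁ V ≤ q ⁻¹ᵁ (V ⊓ U)) :
    M ⟶ (Scheme.Modules.pushforward q).obj (SheafOfModules.unit T.ringCatSheaf) where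
  val := PresheafOfModules.homMk
    { app := fun V ↦ AddCommGrpCat.ofHom (he.eval q V.unop (hq V.unop))
      naturality := by
        intro V W i
        ext s
        exact he.eval_map q i.unop (hq V.unop) (hq W.unop) s }
    (fun V r s ↦ he.eval_smul q V.unop (hq V.unop) r s)

end Eval

lemma IsFrame.evalHom_app {T : Scheme.{u}} (q : T ⟶ X) {U : X.Opens} {e : Γ(M, U)}
    (he : IsFrame M U e) (hq : ∀ V : X.Opens, q ⁻¹ᵁ V ≤ q ⁻¹ᵁ (V ⊓ U)) (V : X.Opens)
    (s : Γ(M, V)) :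
    (he.evalHom q hq).app V s = q.appLE (V ⊓ U) (q ⁻¹ᵁ V) (hq V)
      (he.coord inf_le_right (M.presheaf.map (homOfLE inf_le_left).op s)) := rfl

/-- The section `s` of the invertible sheaf `M` vanishes at the point `x`: near `x` its coordinates
vanish at `x`. -/
def VanishesAt {V : X.Opens} (s : Γ(M, V)) (x : X) : Prop :=
  ∀ (U : X.Opens) (h : U ≤ V) (e : Γ(M, U)) (f : Γ(X, U)), IsFrame M U e → x ∈ U →
    M.presheaf.map (homOfLE h).op s = f • e → x ∉ X.basicOpen f

/-- One frame suffices to test vanishing: on the overlap the coordinate in any other frame is a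
multiple of the coordinate in this one. -/
lemma vanishesAt_iff {U V : X.Opens} (h : U ≤ V) {s : Γ(M, V)} {x : X} {e : Γ(M, U)}
    {f : Γ(X, U)} (he : IsFrame M U e) (hx : x ∈ U)
    (hs : M.presheaf.map (homOfLE h).op s = f • e) : VanishesAt s x ↔ x ∉ X.basicOpen f := by
  refine ⟨fun H ↦ H U h e f he hx hs, fun H U' h' e' f' he' hx' hs' hf' ↦ H ?_⟩
  have hU : U ⊓ U' ≤ U := inf_le_left
  have hU' : U ⊓ U' ≤ U' := inf_le_right
  have h1 : M.presheaf.map (homOfLE hU).op (M.presheaf.map (homOfLE h).op s) =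
      M.presheaf.map (homOfLE hU').op (M.presheaf.map (homOfLE h').op s) := by
    rw [← ConcreteCategory.comp_apply, ← ConcreteCategory.comp_apply, ← Functor.map_comp,
      ← Functor.map_comp]
    rfl
  rw [hs, hs', Scheme.Modules.map_smul, Scheme.Modules.map_smul,
    he'.coord_smul hU' (M.presheaf.map (homOfLE hU).op e), ← mul_smul] at h1
  have h2 := (he'.coord_eq hU' h1.symm).symm.trans (he'.coord_eq hU' rfl)
  have h3 : x ∈ X.basicOpen (X.presheaf.map (homOfLE hU').op f') := by
    rw [Scheme.basicOpen_res]
    exact ⟨⟨hx, hx'⟩, hf'⟩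
  rw [← h2, Scheme.basicOpen_mul, Scheme.basicOpen_res] at h3
  exact h3.1.2

lemma IsInvertible.exists_frame (hM : IsInvertible M) {V : X.Opens} (s : Γ(M, V)) {x : X}
    (hx : x ∈ V) : ∃ (U : X.Opens) (h : U ≤ V) (e : Γ(M, U)) (f : Γ(X, U)), x ∈ U ∧
      IsFrame M U e ∧ M.presheaf.map (homOfLE h).op s = f • e := by
  obtain ⟨U, hxU, e, he⟩ := hM x
  refine ⟨V ⊓ U, inf_le_left, M.presheaf.map (homOfLE inf_le_right).op e, _, ⟨hx, hxU⟩,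
    he.restrict _, he.coord_smul inf_le_right _⟩

lemma isOpen_not_vanishesAt (hM : IsInvertible M) {V : X.Opens} (s : Γ(M, V)) :
    IsOpen {x | x ∈ V ∧ ¬ VanishesAt s x} := by
  rw [isOpen_iff_forall_mem_open]
  rintro x ⟨hxV, hx⟩
  obtain ⟨U, h, e, f, hxU, he, hs⟩ := hM.exists_frame s hxV
  refine ⟨X.basicOpen f, fun y hy ↦ ?_, (X.basicOpen f).2, ?_⟩
  · have hyU := X.basicOpen_le f hy
    refine ⟨h hyU, ?_⟩
    rw [vanishesAt_iff h he hyU hs]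
    exact not_not.2 hy
  · rw [vanishesAt_iff h he hxU hs] at hx
    exact not_not.1 hx

lemma vanishesAt_map_iff {V W : X.Opens} (h : W ≤ V) (hM : IsInvertible M) (s : Γ(M, V)) {x : X}
    (hx : x ∈ W) : VanishesAt (M.presheaf.map (homOfLE h).op s) x ↔ VanishesAt s x := by
  obtain ⟨U, h', e, f, hxU, he, hs⟩ := hM.exists_frame (M.presheaf.map (homOfLE h).op s) hx
  rw [vanishesAt_iff h' he hxU hs]
  rw [← ConcreteCategory.comp_apply, ← Functor.map_comp] at hs
  exact (vanishesAt_iff (h'.trans h) he hxU hs).symm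

lemma eq_zero_of_basicOpen_eq_bot [IsReduced X] {U : X.Opens} (f : Γ(X, U))
    (h : ∀ x ∈ U, x ∉ X.basicOpen f) : f = 0 := by
  rw [← basicOpen_eq_bot_iff]
  ext x
  simp only [SetLike.mem_coe]
  exact ⟨fun hx ↦ (h x (X.basicOpen_le f hx) hx).elim, fun hx ↦ hx.elim⟩

/-- Sections of a sheaf of modules that agree near every point are equal. -/
lemma section_eq_zero_of_locally {V : X.Opens} (s : Γ(M, V))
    (H : ∀ x ∈ V, ∃ (U : X.Opens) (h : U ≤ V), x ∈ U ∧ M.presheaf.map (homOfLE h).op s = 0) :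
    s = 0 := by
  choose! U h hx hs using H
  refine TopCat.Sheaf.eq_of_locally_eq' ⟨M.presheaf, M.isSheaf⟩ (fun x : V ↦ U x.1) V
    (fun x ↦ homOfLE (h x.1 x.2)) ?_ s 0 ?_
  · intro x hxV
    exact Opens.mem_iSup.2 ⟨⟨x, hxV⟩, hx x hxV⟩
  · intro x
    exact (hs x.1 x.2).trans (map_zero _).symm

lemma eq_zero_of_vanishesAt [IsReduced X] (hM : IsInvertible M) {V : X.Opens} (s : Γ(M, V))
    (H : ∀ x ∈ V, VanishesAt s x) : s = 0 := by
  apply section_eq_zero_of_locally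
  intro x hx
  obtain ⟨U, h, e, f, hxU, he, hs⟩ := hM.exists_frame s hx
  refine ⟨U, h, hxU, ?_⟩
  rw [hs, eq_zero_of_basicOpen_eq_bot f, zero_smul]
  intro y hy
  exact (vanishesAt_iff h he hy hs).1 (H y (h hy))

/-- The pullback of sections along a morphism. -/
abbrev pullbackUnit (f : Y ⟶ X) (M : X.Modules) :
    M ⟶ (Scheme.Modules.pushforward f).obj ((Scheme.Modules.pullback f).obj M) :=
  (Scheme.Modules.pullbackPushforwardAdjunction f).unit.app M

/-- A morphism to a pushforward kills the sections that are killed by the pullback. -/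
lemma app_eq_zero_of_pullbackUnit (f : Y ⟶ X) {N : Y.Modules}
    (h : M ⟶ (Scheme.Modules.pushforward f).obj N) {V : X.Opens} {s : Γ(M, V)}
    (hs : (pullbackUnit f M).app V s = 0) : h.app V s = 0 := by
  have := (Scheme.Modules.pullbackPushforwardAdjunction f).homEquiv_unit (X := M) (Y := N)
    (f := ((Scheme.Modules.pullbackPushforwardAdjunction f).homEquiv M N).symm h)
  rw [Equiv.apply_symm_apply] at this
  rw [this, Scheme.Modules.Hom.comp_app, ConcreteCategory.comp_apply, hs, map_zero]

/-- Evaluating coordinates in the residue field at `y` is a morphism from `M` to a pushforward along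
`f`, hence factors through the pullback of sections. -/
lemma vanishesAt_of_pullbackUnit_eq_zero (f : Y ⟶ X) {V : X.Opens} {s : Γ(M, V)}
    (hs : (pullbackUnit f M).app V s = 0) (y : Y) : VanishesAt s (f y) := by
  intro U h e a he hxU hsU
  -- The spectrum of the residue field is a single point, and it maps into `U`.
  have hq : ∀ V : X.Opens, (Y.fromSpecResidueField y ≫ f) ⁻¹ᵁ V ≤
      (Y.fromSpecResidueField y ≫ f) ⁻¹ᵁ (V ⊓ U) := by
    intro V t ht
    refine ⟨ht, ?_⟩
    change (Y.fromSpecResidueField y ≫ f) t ∈ U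
    simpa using hxU
  have h1 : (he.evalHom (Y.fromSpecResidueField y ≫ f) hq).app V s = 0 :=
    app_eq_zero_of_pullbackUnit f (N := (Scheme.Modules.pushforward (Y.fromSpecResidueField y)).obj
      (SheafOfModules.unit (Spec (Y.residueField y)).ringCatSheaf))
      (he.evalHom (Y.fromSpecResidueField y ≫ f) hq) hs
  rw [he.evalHom_app] at h1
  have h2 := congrArg (Spec (Y.residueField y)).basicOpen h1
  intro hb
  have h3 : he.coord (inf_le_right : V ⊓ U ≤ U) (M.presheaf.map (homOfLE inf_le_left).op s) =
      X.presheaf.map (homOfLE inf_le_right).op a := by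
    apply he.coord_eq
    rw [← Scheme.Modules.map_smul, ← hsU, ← ConcreteCategory.comp_apply, ← Functor.map_comp]
    rfl
  rw [h3, Scheme.basicOpen_appLE, Scheme.basicOpen_res] at h2
  have h4 : IsLocalRing.closedPoint (Y.residueField y) ∈
      (Spec (Y.residueField y)).basicOpen (0 : Γ(Spec (Y.residueField y),
        (Y.fromSpecResidueField y ≫ f) ⁻¹ᵁ V)) := by
    refine h2.le ?_
    have h5 : (Y.fromSpecResidueField y ≫ f) (IsLocalRing.closedPoint (Y.residueField y)) = f y :=
      congrArg f (Scheme.fromSpecResidueField_apply y _)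
    refine ⟨?_, ⟨?_, ?_⟩, ?_⟩
    · change _ ∈ V
      rw [h5]; exact h hxU
    · change _ ∈ V
      rw [h5]; exact h hxU
    · change _ ∈ U
      rw [h5]; exact hxU
    · change _ ∈ X.basicOpen a
      rw [h5]; exact hb
  rw [Scheme.basicOpen_zero] at h4
  exact h4

lemma pullbackUnit_smul (f : Y ⟶ X) {U : X.Opens} (a : Γ(X, U)) (e : Γ(M, U)) :
    (pullbackUnit f M).app U (a • e) =
      (f.app U a • (show Γ((Scheme.Modules.pullback f).obj M, f ⁻¹ᵁ U) from
        (pullbackUnit f M).app U e)) :=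
  Scheme.Modules.Hom.app_smul _ _ _

lemma pullbackUnit_map (f : Y ⟶ X) {U V : X.Opens} (h : U ≤ V) (s : Γ(M, V)) :
    (pullbackUnit f M).app U (M.presheaf.map (homOfLE h).op s) =
      ((Scheme.Modules.pullback f).obj M).presheaf.map
        (homOfLE (show f ⁻¹ᵁ U ≤ f ⁻¹ᵁ V from fun _ hx ↦ h hx)).op
          ((pullbackUnit f M).app V s) :=
  ConcreteCategory.congr_hom ((pullbackUnit f M).mapPresheaf.naturality (homOfLE h).op) s

/-- Locally the pullback is a function times the pullback of a frame, and a function without nonzero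
values on a reduced scheme is zero. -/
lemma pullbackUnit_eq_zero [IsReduced Y] (f : Y ⟶ X) (hM : IsInvertible M) {V : X.Opens}
    {s : Γ(M, V)} (H : ∀ y, f y ∈ V → VanishesAt s (f y)) : (pullbackUnit f M).app V s = 0 := by
  apply section_eq_zero_of_locally (M := (Scheme.Modules.pullback f).obj M) (V := f ⁻¹ᵁ V)
  intro y hy
  obtain ⟨U, h, e, a, hxU, he, hs⟩ := hM.exists_frame s hy
  refine ⟨f ⁻¹ᵁ U, fun _ hx ↦ h hx, hxU, ?_⟩
  rw [← pullbackUnit_map f h, hs, pullbackUnit_smul, eq_zero_of_basicOpen_eq_bot (f.app U a),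
    zero_smul]
  intro z hz
  rw [← Scheme.preimage_basicOpen]
  exact (vanishesAt_iff h he hz hs).1 (H z (h hz))

end Frames

/-! ### Vanishing under pullback, and factorization of linking maps -/

section Frames

variable {X Y : Scheme.{u}} {M : X.Modules}

lemma VanishesAt.of_map {V W : X.Opens} (h : W ≤ V) {s : Γ(M, V)} {x : X} (hx : x ∈ W)
    (H : VanishesAt (M.presheaf.map (homOfLE h).op s) x) : VanishesAt s x := by
  intro U hU e f he hxU hs hf
  refine H (U ⊓ W) inf_le_right _ (X.presheaf.map (homOfLE inf_le_left).op f)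
    (he.restrict inf_le_left) ⟨hxU, hx⟩ ?_ ?_
  · rw [← Scheme.Modules.map_smul, ← hs, ← ConcreteCategory.comp_apply,
      ← ConcreteCategory.comp_apply, ← Functor.map_comp, ← Functor.map_comp]
    rfl
  · rw [Scheme.basicOpen_res]
    exact ⟨⟨hxU, hx⟩, hf⟩

lemma vanishesAt_smul {V : X.Opens} (a : Γ(X, V)) (s : Γ(M, V)) {x : X}
    (hx : x ∉ X.basicOpen a) : VanishesAt (a • s) x := by
  intro U hU e f he hxU hs hf
  rw [Scheme.Modules.map_smul, he.coord_smul le_rfl (M.presheaf.map (homOfLE hU).op s),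
    ← mul_smul] at hs
  have h1 : M.presheaf.map (homOfLE (le_refl U)).op e = e := by
    have : (homOfLE (le_refl U)).op = 𝟙 _ := rfl
    rw [this, M.presheaf.map_id]
    rfl
  have h2 := (he.coord_eq le_rfl hs.symm).symm.trans (he.coord_eq le_rfl (by rw [h1]))
  rw [← h2, Scheme.basicOpen_mul, Scheme.basicOpen_res] at hf
  exact hx hf.1.2

lemma VanishesAt.pullbackUnit (f : Y ⟶ X) (hM : IsInvertible M) {V : X.Opens} {s : Γ(M, V)} {y : Y}
    (hy : f y ∈ V) (hs : VanishesAt s (f y)) :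
    VanishesAt (M := (Scheme.Modules.pullback f).obj M) (V := f ⁻¹ᵁ V)
      ((pullbackUnit f M).app V s) y := by
  obtain ⟨U, h, e, a, hxU, he, hsU⟩ := hM.exists_frame s hy
  rw [vanishesAt_iff h he hxU hsU] at hs
  refine VanishesAt.of_map (W := f ⁻¹ᵁ U) (fun _ hx ↦ h hx) hxU ?_
  rw [← pullbackUnit_map f h, hsU, pullbackUnit_smul]
  apply vanishesAt_smul
  rw [← Scheme.preimage_basicOpen]
  exact hs

lemma app_injective_of_mono {L M : X.Modules} (φ : L ⟶ M) [Mono φ] (U : X.Opens) :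
    Function.Injective (φ.app U) := by
  have h1 : Mono ((Scheme.Modules.toPresheaf X).map φ) := inferInstance
  have h2 : Mono (((Scheme.Modules.toPresheaf X).map φ).app (op U)) := inferInstance
  exact (AddCommGrpCat.mono_iff_injective _).1 h2

/-- After the restriction to `Y` come only an isomorphism and a kernel inclusion, which are
injective on sections. -/
lemma FactorsThrough.restrictMap_eq_zero {L M : X.Modules} {φ : L ⟶ M} {Y Z : Closeds X}
    (h : FactorsThrough φ Y Z) {U : X.Opens} {s : Γ(L, U)} (hs : φ.app U s = 0) :
    (restrictMap Y L).app U s = 0 := by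
  obtain ⟨e, rfl⟩ := h
  refine app_injective_of_mono (e.hom ≫ kernel.ι (restrictMap Z M)) U ?_
  rw [map_zero, ← hs]
  rfl

end Frames

/-! ### Closed subsets with their reduced structure -/

section Reduced

variable {X : Scheme.{u}}

lemma range_incl (Y : Closeds X) : Set.range (incl Y) = Y := by
  rw [Scheme.IdealSheafData.range_subschemeι, Scheme.IdealSheafData.coe_support_vanishingIdeal]

lemma isReduced_reduced (Y : Closeds X) : IsReduced (reduced Y) := by
  have : ∀ i, IsReduced
      ((Scheme.IdealSheafData.vanishingIdeal Y).subschemeCover.openCover.X i) := by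
    intro (U : X.affineOpens)
    have : _root_.IsReduced (Γ(X, U) ⧸ (Scheme.IdealSheafData.vanishingIdeal Y).ideal U) := by
      rw [← Ideal.isRadical_iff_quotient_reduced, Scheme.IdealSheafData.vanishingIdeal_ideal]
      exact PrimeSpectrum.isRadical_vanishingIdeal _
    exact inferInstanceAs (IsReduced (Spec (CommRingCat.of
      (Γ(X, U) ⧸ (Scheme.IdealSheafData.vanishingIdeal Y).ideal U))))
  exact AlgebraicGeometry.IsReduced.of_openCover _
    (Scheme.IdealSheafData.vanishingIdeal Y).subschemeCover.openCover

/-- A section of an invertible sheaf restricts to zero on a closed subset with its reduced structure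
if and only if it vanishes at every point. -/
lemma restrictMap_app_eq_zero_iff {M : X.Modules} (hM : IsInvertible M) (Y : Closeds X)
    {V : X.Opens} (s : Γ(M, V)) :
    (restrictMap Y M).app V s = 0 ↔ ∀ x ∈ Y, x ∈ V → VanishesAt s x := by
  have := isReduced_reduced Y
  have hr := range_incl Y
  constructor
  · intro h x hx hxV
    rw [← SetLike.mem_coe, ← hr] at hx
    obtain ⟨y, rfl⟩ := hx
    exact vanishesAt_of_pullbackUnit_eq_zero (incl Y) h y
  · intro h
    apply pullbackUnit_eq_zero (incl Y) hM
    intro y hy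
    refine h _ ?_ hy
    rw [← SetLike.mem_coe, ← hr]
    exact ⟨y, rfl⟩

lemma isIrreducible_of_isIntegral_reduced (Y : Closeds X) [IsIntegral (reduced Y)] :
    IsIrreducible (Y : Set X) := by
  rw [← range_incl, ← Set.image_univ]
  exact (IrreducibleSpace.isIrreducible_univ _).image _ (incl Y).continuous.continuousOn

lemma not_subset_singleton_of_dim (Y : Closeds X)
    (h : topologicalKrullDim (reduced Y) = 1) (x : X) : ¬ (Y : Set X) ⊆ {x} := by
  intro hY
  have hs : Subsingleton (reduced Y) := by
    constructor
    intro a b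
    apply (incl Y).isEmbedding.injective
    have ha := hY ((range_incl Y).le ⟨a, rfl⟩)
    have hb := hY ((range_incl Y).le ⟨b, rfl⟩)
    exact ha.trans hb.symm
  have := topologicalKrullDim_zero_of_discreteTopology (reduced Y)
  rw [h] at this
  exact absurd this (by decide)

end Reduced

/-! ### Orders of vanishing and the degree bound -/

section Order

variable {C : Scheme.{u}} [IsIntegral C]

/-- The dimension bounds the coheight by one; coheight zero would make the closed point generic, so
that the curve would be a single point. -/
lemma coheight_eq_one_of_isClosed (h : topologicalKrullDim C = 1) {x : C}
    (hx : IsClosed {x}) : Order.coheight x = 1 := by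
  apply le_antisymm
  · have h1 : Order.krullDim C = 1 := by
      rw [← h, topologicalKrullDim]
      exact (Order.krullDim_eq_of_orderIso (irreducibleSetEquivPoints (α := C))).symm
    have := Order.coheight_le_krullDim x
    rw [h1] at this
    exact_mod_cast this
  · rw [Order.one_le_iff_pos, Order.coheight_pos]
    intro hmax
    have hgen : x = genericPoint C := by
      have h1 : x ⤳ genericPoint C := hmax (b := genericPoint C) (genericPoint_specializes x)
      exact (hx.closure_eq ▸ h1.mem_closure : genericPoint C ∈ ({x} : Set C)).symm
    have huniv : ({x} : Set C) = Set.univ := by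
      rw [← hx.closure_eq, hgen]
      exact genericPoint_closure C
    have hs : Subsingleton C := Set.subsingleton_univ_iff.1 (huniv ▸ Set.subsingleton_singleton)
    have := topologicalKrullDim_zero_of_discreteTopology C
    rw [h] at this
    exact absurd this (by decide)

variable [IsLocallyNoetherian C]

lemma ord_nonneg {U : C.Opens} [Nonempty U] (f : Γ(C, U)) {x : C} (hx : x ∈ U) :
    0 ≤ Scheme.ord (C.germToFunctionField U f) x := by
  by_cases hf : f = 0
  · rw [hf, map_zero, Scheme.ord_zero]; rfl
  have h1 := Scheme.ord_le_smul hx hf (1 : C.functionField)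
  rw [Algebra.smul_def, mul_one] at h1
  have h2 : Scheme.ord (1 : C.functionField) x = 0 := by
    have := Scheme.ord_of_isUnit (f := (1 : Γ(C, U))) isUnit_one hx
    rwa [map_one] at this
  rw [h2] at h1
  exact h1

/-- Order zero means that the local ring modulo the germ of `f` has length zero, so the germ is a
unit and `f` does not vanish at `x`. -/
lemma one_le_ord {U : C.Opens} [Nonempty U] {f : Γ(C, U)} (hf : f ≠ 0) {x : C} (hx : x ∈ U)
    (hfx : x ∉ C.basicOpen f) (hc : Order.coheight x = 1) :
    1 ≤ Scheme.ord (C.germToFunctionField U f) x := by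
  refine (ord_nonneg f hx).lt_of_ne fun h0 ↦ hfx ?_
  have hf' : C.germToFunctionField U f ≠ 0 :=
    (map_ne_zero_iff _ (Scheme.germToFunctionField_injective C U)).2 hf
  have h1 := (Scheme.ord_eq_iff hc hf').1 h0.symm
  have : Ring.KrullDimLE 1 (C.presheaf.stalk x) := krullDimLE_of_coheight_le hc.le
  rw [← Scheme.algebraMap_germ_eq_germToFunctionField _ hx] at h1
  have hg : C.presheaf.germ U x hx f ≠ 0 := by
    intro h
    rw [← Scheme.algebraMap_germ_eq_germToFunctionField _ hx, h, map_zero] at hf'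
    exact hf' rfl
  have h2 : Ring.ordMonoidWithZeroHom (C.presheaf.stalk x) (C.presheaf.germ U x hx f) = 1 :=
    (Ring.ordFrac_eq_ord (K := C.functionField) _ hg).symm.trans h1
  have hnz := mem_nonZeroDivisors_of_ne_zero hg
  obtain ⟨n, hn⟩ := ENat.ne_top_iff_exists.1 (Ring.ord_ne_top hnz)
  rw [Ring.ordMonoidWithZeroHom_eq_coe _ hnz hn.symm] at h2
  have hn0 : n = 0 := by
    have h3 : Multiplicative.ofAdd (n : ℤ) = 1 := by exact_mod_cast h2
    exact_mod_cast (ofAdd_eq_one.1 h3)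
  rw [Scheme.mem_basicOpen _ _ _ hx]
  rw [hn0, Ring.ord] at hn
  have h4 := Module.length_eq_zero_iff.1 hn.symm
  rw [Submodule.Quotient.subsingleton_iff] at h4
  exact Ideal.span_singleton_eq_top.1 h4

/-- A nonzero section of an invertible sheaf of degree `n` vanishes at no more than `n` closed
points. -/
lemma HasDegree.card_le {M : C.Modules} {n : ℤ} (hM : HasDegree M n) {s : Γ(M, ⊤)} (hs : s ≠ 0)
    (T : Finset C) (hT : ∀ x ∈ T, Order.coheight x = 1 ∧ VanishesAt s x) : (T.card : ℤ) ≤ n := by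
  obtain ⟨D, hD, hn⟩ := hM ⊤ s hs
  -- The frames come with the orders of vanishing of the nonzero section `s`.
  have hinv : IsInvertible M := by
    intro x
    obtain ⟨W, e, -, -, hx, he, -⟩ := hD x
    exact ⟨W, hx, e, he⟩
  have hpos : ∀ x, 0 ≤ D x := by
    intro x
    obtain ⟨W, e, f, _, hx, he, -, ho⟩ := hD x
    rw [← ho]
    exact ord_nonneg f ⟨trivial, hx⟩
  have hone : ∀ x ∈ T, 1 ≤ D x := by
    intro x hxT
    obtain ⟨hc, hv⟩ := hT x hxT
    obtain ⟨W, e, f, hne, hx, he, hsf, ho⟩ := hD x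
    have hxW : x ∈ ⊤ ⊓ W := ⟨trivial, hx⟩
    have he' := he.restrict (inf_le_right : ⊤ ⊓ W ≤ W)
    rw [← ho]
    refine one_le_ord ?_ hxW ((vanishesAt_iff inf_le_left he' hxW hsf).1 hv) hc
    -- The nonvanishing locus of `s` is open and nonempty, so it meets `W` by irreducibility, which
    -- excludes a zero coordinate there.
    intro hf0
    obtain ⟨y, hy⟩ : ∃ y, ¬ VanishesAt s y := by
      by_contra! h
      exact hs (eq_zero_of_vanishesAt hinv s fun x _ ↦ h x)
    obtain ⟨z, hz, hzW⟩ := nonempty_preirreducible_inter (isOpen_not_vanishesAt hinv s)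
      (⊤ ⊓ W : C.Opens).isOpen ⟨y, trivial, hy⟩ ⟨x, hxW⟩
    refine hz.2 ((vanishesAt_iff inf_le_left he' hzW hsf).2 ?_)
    rw [hf0, Scheme.basicOpen_zero]
    exact id
  rw [← hn, Finsupp.sum]
  calc (T.card : ℤ) = ∑ x ∈ T, 1 := by simp
    _ ≤ ∑ x ∈ T, D x := Finset.sum_le_sum hone
    _ ≤ ∑ x ∈ D.support, D x := by
      apply Finset.sum_le_sum_of_subset_of_nonneg
      · intro x hx
        have := hone x hx
        rw [Finsupp.mem_support_iff]
        omega
      · intro x _ _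
        exact hpos x

end Order

/-! ### Sections vanishing on components of the curve -/

namespace ThreeComponentCurve

variable {k : Type u} [Field k] (C : ThreeComponentCurve k)

lemma compl_eq (q : Fin 3) : C.compl q = C.component (q + 1) ⊔ C.component (q + 2) := by
  apply le_antisymm
  · refine iSup₂_le fun p hp ↦ ?_
    have : p = q + 1 ∨ p = q + 2 := by revert p q; decide
    rcases this with rfl | rfl
    · exact le_sup_left
    · exact le_sup_right
  · refine sup_le ?_ ?_
    · exact le_iSup₂_of_le (q + 1) (by revert q; decide) le_rfl
    · exact le_iSup₂_of_le (q + 2) (by revert q; decide) le_rfl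

lemma mem_compl_iff {q : Fin 3} {x : C.X} :
    x ∈ C.compl q ↔ x ∈ C.component (q + 1) ∨ x ∈ C.component (q + 2) := by
  rw [compl_eq, ← SetLike.mem_coe, Closeds.coe_sup]
  rfl

lemma component_le_compl {p q : Fin 3} (h : p ≠ q) : C.component p ≤ C.compl q :=
  le_iSup₂_of_le p h le_rfl

lemma mem_component_or_compl (q : Fin 3) (x : C.X) : x ∈ C.component q ∨ x ∈ C.compl q := by
  have h : (⊤ : Closeds C.X) ≤ C.component q ⊔ C.compl q := by
    rw [← C.union]
    refine iSup_le fun p ↦ ?_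
    by_cases hp : p = q
    · rw [hp]; exact le_sup_left
    · exact (C.component_le_compl hp).trans le_sup_right
  have h1 : x ∈ ((C.component q ⊔ C.compl q : Closeds C.X) : Set C.X) := h (Set.mem_univ x)
  rw [Closeds.coe_sup] at h1
  exact h1

lemma inf_of_sup_vanishingIdeal {X : Scheme.{u}} {Y Z : Closeds X} {x : X} {hx : IsClosed {x}}
    (h : Scheme.IdealSheafData.vanishingIdeal Y ⊔ Scheme.IdealSheafData.vanishingIdeal Z =
      Scheme.IdealSheafData.vanishingIdeal ⟨{x}, hx⟩) (y : X) : y ∈ Y ∧ y ∈ Z ↔ y = x := by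
  have h1 := congrArg (fun I ↦ (I.support : Set X)) h
  simp only [Scheme.IdealSheafData.support_sup, Closeds.coe_inf,
    Scheme.IdealSheafData.coe_support_vanishingIdeal] at h1
  exact Set.ext_iff.1 h1 y

lemma mem_A (y : C.X) : y ∈ C.component 0 ∧ y ∈ C.component 1 ↔ y = C.A :=
  inf_of_sup_vanishingIdeal C.meet_A y

lemma mem_B (y : C.X) : y ∈ C.component 1 ∧ y ∈ C.component 2 ↔ y = C.B :=
  inf_of_sup_vanishingIdeal C.meet_B y

lemma not_mem_zero_two (y : C.X) (h0 : y ∈ C.component 0) (h2 : y ∈ C.component 2) : False := by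
  have : y ∈ C.component 0 ⊓ C.component 2 := ⟨h0, h2⟩
  rw [C.disjoint] at this
  exact this

lemma A_ne_B : C.A ≠ C.B := fun h ↦
  C.not_mem_zero_two C.A ((C.mem_A _).2 rfl).1 (h ▸ ((C.mem_B _).2 rfl).2)

lemma exists_inter_subset_singleton {p q : Fin 3} (h : p ≠ q) :
    ∃ x, ∀ y ∈ C.component p, y ∈ C.component q → y = x := by
  have h01 : ∀ y ∈ C.component 0, y ∈ C.component 1 → y = C.A :=
    fun y h h' ↦ (C.mem_A y).1 ⟨h, h'⟩
  have h12 : ∀ y ∈ C.component 1, y ∈ C.component 2 → y = C.B :=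
    fun y h h' ↦ (C.mem_B y).1 ⟨h, h'⟩
  have h02 : ∀ y ∈ C.component 0, y ∈ C.component 2 → y = C.A :=
    fun y h h' ↦ (C.not_mem_zero_two y h h').elim
  fin_cases p <;> fin_cases q
  · exact (h rfl).elim
  · exact ⟨_, h01⟩
  · exact ⟨_, h02⟩
  · exact ⟨_, fun y h h' ↦ h01 y h' h⟩
  · exact (h rfl).elim
  · exact ⟨_, h12⟩
  · exact ⟨_, fun y h h' ↦ h02 y h' h⟩
  · exact ⟨_, fun y h h' ↦ h12 y h' h⟩
  · exact (h rfl).elim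

/-- Otherwise the irreducible `X_p` would lie in a single other component, which it meets in at most
one point, against its dimension. -/
lemma exists_mem_not_mem_compl (p : Fin 3) : ∃ x ∈ C.component p, x ∉ C.compl p := by
  by_contra! h
  have hirr := (isIrreducible_of_isIntegral_reduced (C.component p)).isPreirreducible
  rw [isPreirreducible_iff_isClosed_union_isClosed] at hirr
  have key : ∀ q, p ≠ q → ¬ (C.component p : Set C.X) ⊆ C.component q := by
    intro q hpq hsub
    obtain ⟨x, hx⟩ := C.exists_inter_subset_singleton hpq
    exact not_subset_singleton_of_dim (C.component p) (C.dim_eq_one p) x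
      fun y hy ↦ hx y hy (hsub hy)
  rcases hirr _ _ (C.component (p + 1)).isClosed (C.component (p + 2)).isClosed
    (fun x hx ↦ C.mem_compl_iff.1 (h x hx)) with h1 | h1
  · exact key (p + 1) (by clear * -; revert p; decide) h1
  · exact key (p + 2) (by clear * -; revert p; decide) h1

/-- The points that lie on no component other than `X_p`. -/
def interior (p : Fin 3) : C.X.Opens := (C.compl p).compl

variable {C} {L M : C.X.Modules}

lemma mem_vanishing_iff (hL : IsInvertible L) {Y : Closeds C.X} {s : C.H0 L} :
    s ∈ C.vanishing L Y ↔ ∀ x ∈ Y, VanishesAt (M := L) (V := ⊤) s x :=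
  (restrictMap_app_eq_zero_iff hL Y (V := ⊤) s).trans
    ⟨fun h x hx ↦ h x hx trivial, fun h x hx _ ↦ h x hx⟩

lemma mapH0_mem_vanishing (φ : L ⟶ M) {Y : Closeds C.X} {s : C.H0 L}
    (hs : s ∈ C.vanishing L Y) : C.mapH0 φ s ∈ C.vanishing M Y := by
  have h1 := (Scheme.Modules.pullbackPushforwardAdjunction (incl Y)).unit.naturality φ
  have h2 := congrArg (fun ψ ↦ ψ.app ⊤) h1
  have h3 := ConcreteCategory.congr_hom h2 s
  have hs' : (restrictMap Y L).app ⊤ s = 0 := hs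
  change (restrictMap Y M).app ⊤ (φ.app ⊤ s) = 0
  refine h3.trans ?_
  change ((Scheme.Modules.pullback (incl Y) ⋙ Scheme.Modules.pushforward (incl Y)).map φ).app ⊤
    ((restrictMap Y L).app ⊤ s) = 0
  rw [hs']
  exact map_zero (((Scheme.Modules.pushforward (incl Y)).map
    ((Scheme.Modules.pullback (incl Y)).map φ)).app ⊤).hom

/-- A section of an invertible sheaf that vanishes on the points of `X_p` that lie on no other
component vanishes on `X_p`. -/
lemma mem_vanishing_component_of_interior (hL : IsInvertible L) {p : Fin 3} {s : C.H0 L}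
    (h : ∀ x ∈ C.interior p, VanishesAt (M := L) (V := ⊤) s x) :
    s ∈ C.vanishing L (C.component p) := by
  rw [mem_vanishing_iff hL]
  by_contra! H
  obtain ⟨x, hx, hsx⟩ := H
  obtain ⟨y, hy, hy'⟩ := C.exists_mem_not_mem_compl p
  -- Two open sets that meet the irreducible `X_p` meet each other on it.
  obtain ⟨z, -, hz, hz'⟩ := (isIrreducible_of_isIntegral_reduced (C.component p)).isPreirreducible
    _ _ (isOpen_not_vanishesAt hL (V := ⊤) s) (C.interior p).isOpen ⟨x, hx, trivial, hsx⟩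
    ⟨y, hy, hy'⟩
  exact hz.2 (h z hz')

/-- Away from the other components, vanishing on `X_p` means being zero, since the curve is reduced.
There `φ` loses nothing beyond restriction to `Y`, so `s` vanishes on a dense part of `X_p`. This
gives the injectivity on the quotients. -/
lemma mem_vanishing_of_mapH0 (hL : IsInvertible L) (hM : IsInvertible M) {φ : L ⟶ M}
    {Y Z : Closeds C.X} (hφ : FactorsThrough φ Y Z) {p : Fin 3} (hp : C.component p ≤ Y)
    {s : C.H0 L} (hs : C.mapH0 φ s ∈ C.vanishing M (C.component p)) :
    s ∈ C.vanishing L (C.component p) := by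
  rw [mem_vanishing_iff hM] at hs
  apply mem_vanishing_component_of_interior hL
  intro x hx
  have hsub : ∀ y ∈ C.interior p, y ∈ C.component p := fun y hy ↦
    (C.mem_component_or_compl p y).resolve_right hy
  have h1 : M.presheaf.map (homOfLE (le_top : C.interior p ≤ ⊤)).op (φ.app ⊤ s) = 0 := by
    apply eq_zero_of_vanishesAt hM
    intro y hy
    rw [vanishesAt_map_iff le_top hM _ hy]
    exact hs y (hsub y hy)
  have h2 : φ.app (C.interior p) (L.presheaf.map (homOfLE le_top).op s) = 0 :=
    (ConcreteCategory.congr_hom (φ.mapPresheaf.naturality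
      (homOfLE (le_top : C.interior p ≤ ⊤)).op) s).trans h1
  have h3 := (restrictMap_app_eq_zero_iff hL Y _).1 (hφ.restrictMap_eq_zero h2) x
    (hp (hsub x hx)) hx
  exact (vanishesAt_map_iff le_top hL _ hx).1 h3

lemma vanishing_compl (hL : IsInvertible L) (q : Fin 3) :
    C.vanishing L (C.compl q) =
      C.vanishing L (C.component (q + 1)) ⊓ C.vanishing L (C.component (q + 2)) := by
  ext s
  simp only [Submodule.mem_inf, mem_vanishing_iff hL, C.mem_compl_iff]
  constructor
  · exact fun h ↦ ⟨fun x hx ↦ h x (.inl hx), fun x hx ↦ h x (.inr hx)⟩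
  · rintro ⟨h1, h2⟩ x (hx | hx)
    · exact h1 x hx
    · exact h2 x hx

/-- A section of an invertible sheaf of degree less than two on `X₂` that vanishes on `X₁` and `X₃`
is zero. -/
lemma eq_zero_of_mem_vanishing (hL : IsInvertible L) {n : ℤ} (hn : n < 2)
    (hdeg : HasDegree (restrictTo (C.component 1) L) n) {s : C.H0 L}
    (h0 : s ∈ C.vanishing L (C.component 0)) (h2 : s ∈ C.vanishing L (C.component 2)) :
    s = 0 := by
  have hmem : s ∈ C.vanishing L (C.component 1) := by
    by_contra hs
    rw [mem_vanishing_iff hL] at h0 h2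
    have hlift : ∀ y ∈ C.component 1, IsClosed {y} → VanishesAt (M := L) (V := ⊤) s y →
        ∃ a, incl (C.component 1) a = y ∧ Order.coheight a = 1 ∧
          VanishesAt (M := restrictTo (C.component 1) L) (V := ⊤)
            ((restrictMap (C.component 1) L).app ⊤ s) a := by
      intro y hy hc hv
      obtain ⟨a, rfl⟩ := (range_incl (C.component 1)).ge hy
      refine ⟨a, rfl, coheight_eq_one_of_isClosed (C.dim_eq_one 1) ?_, ?_⟩
      · have : ({a} : Set (reduced (C.component 1))) =
            incl (C.component 1) ⁻¹' {incl (C.component 1) a} := by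
          ext b
          exact ⟨fun h ↦ congrArg _ h, fun h ↦ (incl (C.component 1)).isEmbedding.injective h⟩
        rw [this]
        exact hc.preimage (incl (C.component 1)).continuous
      · exact VanishesAt.pullbackUnit (incl (C.component 1)) hL (V := ⊤) trivial hv
    have hA := (C.mem_A C.A).2 rfl
    have hB := (C.mem_B C.B).2 rfl
    obtain ⟨a, ha, hca, hva⟩ := hlift C.A hA.2 C.isClosed_A (h0 _ hA.1)
    obtain ⟨b, hb, hcb, hvb⟩ := hlift C.B hB.1 C.isClosed_B (h2 _ hB.2)
    have hab : a ≠ b := by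
      rintro rfl
      exact C.A_ne_B (ha.symm.trans hb)
    classical
    -- Points above `A` and `B` are two distinct zeros, too many for a degree below two.
    have := hdeg.card_le (s := (restrictMap (C.component 1) L).app ⊤ s) hs {a, b} (by
      intro x hx
      simp only [Finset.mem_insert, Finset.mem_singleton] at hx
      rcases hx with rfl | rfl
      · exact ⟨hca, hva⟩
      · exact ⟨hcb, hvb⟩)
    rw [Finset.card_pair hab] at this
    push_cast at this
    omega
  rw [mem_vanishing_iff hL] at h0 hmem h2
  refine eq_zero_of_vanishesAt hL (V := ⊤) s fun x _ ↦ ?_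
  rcases C.mem_component_or_compl 0 x with h | h
  · exact h0 x h
  · rcases C.mem_compl_iff.1 h with h | h
    · exact hmem x h
    · exact h2 x h

end ThreeComponentCurve

/-! ### Compatible lifts of bases in a diagram of vector spaces -/

section LinearAlgebra

variable {k : Type*} [Field k]

section

variable {M N Q : Type*} [AddCommGroup M] [Module k M] [AddCommGroup N] [Module k N]
  [AddCommGroup Q] [Module k Q]

/-- Only `T \ R` is new. A common vector of its span and the span of `S` lies in the span of `R`,
which meets the span of `T \ R` trivially as `T` is independent. -/
lemma linearIndepOn_union_of_inf_le {v : M →ₗ[k] Q} {S T R : Set M} (hS : LinearIndepOn k v S)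
    (hT : LinearIndepOn k v T) (hRS : R ⊆ S) (hRT : R ⊆ T)
    (h : Submodule.span k (v '' S) ⊓ Submodule.span k (v '' T) ≤ Submodule.span k (v '' R)) :
    LinearIndepOn k v (S ∪ T) := by
  have h1 : S ∪ T = S ∪ (T \ R) := by
    rw [← Set.union_eq_self_of_subset_right hRS, Set.union_assoc, Set.union_assoc,
      Set.union_sdiff_self]
  rw [h1]
  refine hS.union (hT.mono Set.sdiff_subset) ?_
  rw [← Set.union_sdiff_cancel hRT, linearIndepOn_union_iff Set.disjoint_sdiff_right] at hT
  rw [Submodule.disjoint_def]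
  intro x hx hx'
  exact Submodule.disjoint_def.1 hT.2.2 x
    (h ⟨hx, Submodule.span_mono (Set.image_mono Set.sdiff_subset) hx'⟩) hx'

/-- A linear map `f` that induces an injection of `V ⧸ K` into `N ⧸ K'` preserves independence. -/
lemma linearIndepOn_mkQ_image {V K : Submodule k M} {K' : Submodule k N} {f : M →ₗ[k] N}
    (hf : ∀ s ∈ V, f s ∈ K' → s ∈ K) {S : Set M} (hSV : S ⊆ V)
    (hS : LinearIndepOn k K.mkQ S) : LinearIndepOn k K'.mkQ (f '' S) := by
  refine LinearIndepOn.image_of_comp f K'.mkQ ?_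
  rw [linearIndepOn_iff] at hS ⊢
  intro l hl h0
  refine hS l hl ?_
  have hV : Finsupp.linearCombination k id l ∈ V := by
    refine Submodule.span_le.2 hSV ?_
    have := (Finsupp.mem_span_image_iff_linearCombination k (v := (id : M → M)) (s := S)).2
      ⟨l, hl, rfl⟩
    rwa [Set.image_id] at this
  have h1 := Finsupp.apply_linearCombination k (K'.mkQ ∘ₗ f) id l
  have h2 := Finsupp.apply_linearCombination k K.mkQ id l
  rw [Function.comp_id] at h1 h2
  rw [LinearMap.coe_comp] at h1
  rw [← h1, Function.comp_apply, Submodule.mkQ_apply, Submodule.Quotient.mk_eq_zero] at h0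
  rw [← h2, Submodule.mkQ_apply, Submodule.Quotient.mk_eq_zero]
  exact hf _ hV h0

/-- `T` is contained in `V` and lifts a basis of `V ⧸ K`. -/
structure IsBasisMod (V K : Submodule k M) (T : Set M) : Prop where
  subset : T ⊆ V
  linearIndepOn : LinearIndepOn k K.mkQ T
  le_sup : V ≤ Submodule.span k T ⊔ K

lemma span_mkQ_image (K : Submodule k M) (S : Set M) :
    Submodule.span k (K.mkQ '' S) = (Submodule.span k S).map K.mkQ :=
  Submodule.span_image _

lemma map_mkQ_sup (A K : Submodule k M) : (A ⊔ K).map K.mkQ = A.map K.mkQ := by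
  rw [Submodule.map_sup, Submodule.mkQ_map_self, sup_bot_eq]

lemma map_mkQ_inf_le {A B K W : Submodule k M} (h : (A ⊔ K) ⊓ (B ⊔ K) ≤ W) :
    A.map K.mkQ ⊓ B.map K.mkQ ≤ W.map K.mkQ := by
  intro x hx
  obtain ⟨y, rfl⟩ := K.mkQ_surjective x
  refine Submodule.mem_map_of_mem (h ?_)
  rwa [sup_comm A, sup_comm B, ← Submodule.comap_map_mkQ, ← Submodule.comap_map_mkQ]

lemma exists_isBasisMod (V K : Submodule k M) {S : Set M} (hSV : S ⊆ V)
    (hS : LinearIndepOn k K.mkQ S) : ∃ T, S ⊆ T ∧ IsBasisMod V K T := by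
  refine ⟨hS.extend hSV, hS.subset_extend hSV, hS.extend_subset hSV, hS.linearIndepOn_extend hSV, ?_⟩
  have h := hS.span_image_extend_eq_span_image hSV
  rw [span_mkQ_image, span_mkQ_image, Submodule.span_eq] at h
  intro x hx
  rw [sup_comm, ← Submodule.comap_map_mkQ, h]
  exact Submodule.mem_map_of_mem hx

end

section

variable {ι : Type*} {H : ι → Type*} [∀ a, AddCommGroup (H a)] [∀ a, Module k (H a)]

/-- The map from `a` to `c` along the arrows of `E` factors through `b`. -/
def Through (E : ι → ι → Prop) (f : ∀ a b, H a →ₗ[k] H b) (a b c : ι) : Prop :=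
  E a b ∧ E a c ∧ ∀ s, f b c (f a b s) = f a c s

open Classical in
/-- An extension of the given set to a lift of a basis of `V ⧸ K`, if there is one. -/
def extendMod {M : Type*} [AddCommGroup M] [Module k M] (V K : Submodule k M) (S : Set M) : Set M :=
  -- The value `∅` never occurs in the construction; it lets the recursion be defined before
  -- independence is known.
  if h : ∃ T, S ⊆ T ∧ IsBasisMod V K T then h.choose else ∅

lemma extendMod_spec {M : Type*} [AddCommGroup M] [Module k M] {V K : Submodule k M} {S : Set M}
    (hSV : S ⊆ V) (hS : LinearIndepOn k K.mkQ S) :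
    S ⊆ extendMod V K S ∧ IsBasisMod V K (extendMod V K S) := by
  have h := exists_isBasisMod V K hSV hS
  rw [extendMod, dif_pos h]
  exact h.choose_spec

/-- A diagram of vector spaces `V a` with subspaces `K a`, whose arrows go up in rank and induce
injections of the `V a ⧸ K a`, has compatible lifts of bases of the `V a ⧸ K a` if the arrows
to any given `a` come from at most two others up to factorization, whose images modulo `K a`
intersect in the image of a common predecessor. -/
theorem exists_linked_bases (V K : ∀ a, Submodule k (H a)) (f : ∀ a b, H a →ₗ[k] H b)
    (E : ι → ι → Prop) (rank : ι → ℕ) (hrank : ∀ a b, E b a → rank b < rank a)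
    (hV : ∀ a b, E b a → (V b).map (f b a) ≤ V a)
    (hK : ∀ a b, E b a → ∀ s ∈ V b, f b a s ∈ K a → s ∈ K b)
    (hK' : ∀ a b, E b a → (K b).map (f b a) ≤ K a)
    (hpred : ∀ a, (∀ b, ¬ E b a) ∨
      (∃ b, E b a ∧ ∀ c, E c a → c = b ∨ Through E f c b a) ∨
      ∃ b c, E b a ∧ E c a ∧
        (∀ e, E e a → e = b ∨ e = c ∨ Through E f e b a) ∧
        (((V b).map (f b a) ⊔ K a) ⊓ ((V c).map (f c a) ⊔ K a) ≤ K a ∨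
          ∃ e, Through E f e b a ∧ Through E f e c a ∧
            ((V b).map (f b a) ⊔ K a) ⊓ ((V c).map (f c a) ⊔ K a) ≤ (V e).map (f e a) ⊔ K a)) :
    ∃ β : ∀ a, Set (H a), (∀ a, IsBasisMod (V a) (K a) (β a)) ∧
      ∀ a b, E b a → f b a '' β b ⊆ β a := by
  have hwf : WellFounded (InvImage (· < ·) rank) := InvImage.wf rank wellFounded_lt
  -- Recursion on the rank: extend the union of the images of all earlier bases.
  let β : ∀ a, Set (H a) := hwf.fix fun a rec ↦
    extendMod (V a) (K a) (⋃ (b : ι) (h : E b a), f b a '' rec b (hrank a b h))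
  have hβ : ∀ a, β a = extendMod (V a) (K a) (⋃ (b : ι) (_ : E b a), f b a '' β b) :=
    fun a ↦ hwf.fix_eq _ a
  suffices ∀ a, IsBasisMod (V a) (K a) (β a) ∧ ∀ b, E b a → f b a '' β b ⊆ β a from
    ⟨β, fun a ↦ (this a).1, fun a ↦ (this a).2⟩
  intro a
  induction a using hwf.induction with
  | _ a ih =>
  replace ih : ∀ b, E b a → IsBasisMod (V b) (K b) (β b) ∧ ∀ c, E c b → f c b '' β c ⊆ β b :=
    fun b h ↦ ih b (hrank a b h)
  have hli : ∀ b, E b a → LinearIndepOn k (K a).mkQ (f b a '' β b) := fun b h ↦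
    linearIndepOn_mkQ_image (hK a b h) (ih b h).1.subset (ih b h).1.linearIndepOn
  have hsub : (⋃ (b : ι) (_ : E b a), f b a '' β b) ⊆ V a := by
    refine Set.iUnion₂_subset fun b h ↦ ?_
    exact (Set.image_mono (ih b h).1.subset).trans (hV a b h)
  have hthrough : ∀ e b, E b a → Through E f e b a → f e a '' β e ⊆ f b a '' β b := by
    rintro e b hb ⟨h1, -, h3⟩ _ ⟨s, hs, rfl⟩
    exact ⟨f e b s, (ih b hb).2 e h1 ⟨s, hs, rfl⟩, h3 s⟩
  have hle : ∀ b, E b a →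
      ((V b).map (f b a) ⊔ K a).map (K a).mkQ ≤ Submodule.span k ((K a).mkQ '' (f b a '' β b)) := by
    intro b h
    rw [span_mkQ_image, Submodule.span_image, map_mkQ_sup]
    have h1 := Submodule.map_mono (f := f b a) (ih b h).1.le_sup
    rw [Submodule.map_sup] at h1
    refine (Submodule.map_mono (h1.trans (sup_le_sup_left (hK' a b h) _))).trans ?_
    rw [map_mkQ_sup]
  have hge : ∀ b, E b a →
      Submodule.span k ((K a).mkQ '' (f b a '' β b)) ≤ ((V b).map (f b a)).map (K a).mkQ := by
    intro b h
    rw [span_mkQ_image, Submodule.span_image]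
    exact Submodule.map_mono (Submodule.map_mono (Submodule.span_le.2 (ih b h).1.subset))
  have hind : LinearIndepOn k (K a).mkQ (⋃ (b : ι) (_ : E b a), f b a '' β b) := by
    rcases hpred a with h | ⟨b, hb, h⟩ | ⟨b, c, hb, hc, h, hbc⟩
    · have : (⋃ (b : ι) (_ : E b a), f b a '' β b) = ∅ := by
        simp [h]
      rw [this]
      exact linearIndepOn_empty _ _
    · refine (hli b hb).mono (Set.iUnion₂_subset fun c hc ↦ ?_)
      rcases h c hc with rfl | h
      · exact subset_rfl
      · exact hthrough c b hb h
    · refine LinearIndepOn.mono (s := f b a '' β b ∪ f c a '' β c) (v := (K a).mkQ) ?_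
        (Set.iUnion₂_subset fun e he ↦ ?_)
      · rcases hbc with hbc | ⟨e, heb, hec, hbc⟩
        · refine linearIndepOn_union_of_inf_le (R := ∅) (hli b hb) (hli c hc) (Set.empty_subset _)
            (Set.empty_subset _) ?_
          refine (inf_le_inf (hge b hb) (hge c hc)).trans ((map_mkQ_inf_le hbc).trans ?_)
          rw [Submodule.mkQ_map_self]
          exact bot_le
        -- The common part `R` is the image of the basis at `e`, which reaches `a` through both `b`
        -- and `c`.
        · refine linearIndepOn_union_of_inf_le (hli b hb) (hli c hc) (hthrough e b hb heb)
            (hthrough e c hc hec) ?_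
          exact (inf_le_inf (hge b hb) (hge c hc)).trans
            ((map_mkQ_inf_le hbc).trans (hle e heb.2.1))
      · rcases h e he with rfl | rfl | h
        · exact Set.subset_union_left
        · exact Set.subset_union_right
        · exact (hthrough e b hb h).trans Set.subset_union_left
  have := extendMod_spec hsub hind
  rw [← hβ] at this
  exact ⟨this.2, fun b h ↦ (Set.subset_iUnion₂ (s := fun b (_ : E b a) ↦ f b a '' β b) b h).trans
    this.1⟩

end

end LinearAlgebra

/-! ### Distributive triples in a modular lattice -/

section Distributivity

variable {α : Type*} [Lattice α] [IsModularLattice α] {x y z : α}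

/-- By the modular law the left side is `(x ⊓ (y ⊔ z)) ⊔ y`. -/
lemma sup_inf_sup_le_of_distrib_left (h : x ⊓ (y ⊔ z) ≤ (x ⊓ y) ⊔ (x ⊓ z)) :
    (x ⊔ y) ⊓ (z ⊔ y) ≤ (x ⊓ z) ⊔ y := by
  rw [sup_comm x y, sup_inf_assoc_of_le x (le_sup_right : y ≤ z ⊔ y), sup_comm z y]
  exact sup_le le_sup_right (h.trans (sup_le (inf_le_right.trans le_sup_right) le_sup_left))

/-- In a modular lattice distributivity of a triple does not depend on the element singled out: `h1`
transfers it from `x` to `y`, and the modular law concludes. -/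
lemma sup_inf_sup_le_of_distrib (h : x ⊓ (y ⊔ z) ≤ (x ⊓ y) ⊔ (x ⊓ z)) :
    (y ⊔ x) ⊓ (z ⊔ x) ≤ (y ⊓ z) ⊔ x := by
  have h1 : (x ⊔ z) ⊓ (y ⊔ z) ≤ (x ⊓ y) ⊔ z :=
    sup_inf_sup_le_of_distrib_left (by rwa [sup_comm z y, sup_comm (x ⊓ z)])
  have h2 : y ⊓ (z ⊔ x) ≤ (y ⊓ z) ⊔ x := by
    calc y ⊓ (z ⊔ x) ≤ y ⊓ ((x ⊓ y) ⊔ z) :=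
          le_inf inf_le_left (le_trans
            (le_inf (inf_le_right.trans (sup_comm z x).le) (inf_le_left.trans le_sup_left)) h1)
      _ = (x ⊓ y) ⊔ (z ⊓ y) := by
          rw [inf_comm, sup_inf_assoc_of_le z inf_le_right]
      _ ≤ (y ⊓ z) ⊔ x := sup_le (inf_le_left.trans le_sup_right)
          ((inf_comm z y).le.trans le_sup_left)
  rw [sup_comm y x, sup_inf_assoc_of_le y (le_sup_right : x ≤ z ⊔ x)]
  exact sup_le le_sup_right h2

end Distributivity

/-! ### Steps in the grid of multidegrees -/

section Step

variable {d : ℕ} {a b c : Multidegree d}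

lemma step_zero_iff : Step 0 a b ↔ a.i = b.i + 1 ∧ a.l = b.l := by
  simp only [Step, Fin.forall_fin_succ, Multidegree.deg, twist]
  simp
  omega

lemma step_one_iff : Step 1 a b ↔ b.i = a.i + 1 ∧ b.l = a.l + 1 := by
  simp only [Step, Fin.forall_fin_succ, Multidegree.deg, twist]
  simp
  omega

lemma step_two_iff : Step 2 a b ↔ a.i = b.i ∧ a.l = b.l + 1 := by
  simp only [Step, Fin.forall_fin_succ, Multidegree.deg, twist]
  simp
  omega

lemma Multidegree.ext_of_deg (h : ∀ j, a.deg j = b.deg j) : a = b := by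
  ext
  · exact Int.natCast_inj.1 (h 0)
  · exact Int.natCast_inj.1 (h 2)

lemma Step.left_unique {q : Fin 3} (h : Step q a c) (h' : Step q b c) : a = b :=
  Multidegree.ext_of_deg fun j ↦ by linarith [h j, h' j]

lemma Step.right_unique {q : Fin 3} (h : Step q a b) (h' : Step q a c) : b = c :=
  Multidegree.ext_of_deg fun j ↦ by linarith [h j, h' j]

/-- The pairs of multidegrees whose linking map is injective on sections over `X_q`. -/
def IsLink (q : Fin 3) (b a : Multidegree d) : Prop :=
  (∃ p, p ≠ q ∧ Step p b a) ∨ Step q a b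

end Step

/-! ### Linking maps modulo sections vanishing on `X_q` -/

namespace LimitLinearSeries

variable {k : Type u} [Field k] {C : ThreeComponentCurve k} {d r : ℕ}
  (g : LimitLinearSeries C d r)

lemma factorsThrough_of_isLink {q : Fin 3} {a b : Multidegree d} (h : IsLink q b a) :
    ∃ Y Z, C.component q ≤ Y ∧ FactorsThrough (g.φ b a) Y Z := by
  rcases h with ⟨p, hp, h⟩ | h
  · exact ⟨_, _, C.component_le_compl hp.symm, g.factors_up p b a h⟩
  · exact ⟨_, _, le_rfl, g.factors_down q a b h⟩

lemma map_le_of_isLink {q : Fin 3} {a b : Multidegree d} (h : IsLink q b a) :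
    (g.V b).map (g.link b a) ≤ g.V a := by
  rcases h with ⟨p, -, h⟩ | h
  · exact g.linked_up p b a h
  · exact g.linked_down q a b h

lemma mem_Vvan_of_isLink {q : Fin 3} {a b : Multidegree d} (h : IsLink q b a)
    {s : C.H0 (g.L b)} (hs : s ∈ g.V b) (h' : g.link b a s ∈ g.Vvan a (C.component q)) :
    s ∈ g.Vvan b (C.component q) := by
  obtain ⟨Y, Z, hY, hf⟩ := g.factorsThrough_of_isLink h
  exact ⟨hs, ThreeComponentCurve.mem_vanishing_of_mapH0 (g.invertible b) (g.invertible a) hf hY h'.2⟩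

lemma map_Vvan_le_of_isLink {q : Fin 3} {a b : Multidegree d} (h : IsLink q b a) :
    (g.Vvan b (C.component q)).map (g.link b a) ≤ g.Vvan a (C.component q) := by
  rintro _ ⟨s, hs, rfl⟩
  exact ⟨g.map_le_of_isLink h ⟨s, hs.1, rfl⟩, ThreeComponentCurve.mapH0_mem_vanishing _ hs.2⟩

/-- As the three twists sum to zero, the steps `p'` and `p` together undo the step `q`; the
compatibility of the linking maps identifies the composite. -/
lemma through_of_step {p p' q : Fin 3} (hp' : p' ≠ q) (hpp' : p ≠ p')
    {a b e : Multidegree d} (hb : Step p b a) (he : Step p' e b) (h : Step q a e) :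
    Through (IsLink q) g.link e b a := by
  refine ⟨.inl ⟨p', hp', he⟩, .inr h, fun s ↦ ?_⟩
  have h1 := congrArg (fun ψ ↦ C.mapH0 ψ s) (g.comp p' p e b a hpp'.symm he hb)
  exact h1

lemma Vvan_inf {p p' q : Fin 3} (hp : p ≠ q) (hp' : p' ≠ q) (hpp' : p ≠ p') (a : Multidegree d) :
    g.Vvan a (C.component p) ⊓ g.Vvan a (C.component p') = g.Vvan a (C.compl q) := by
  have h : (p = q + 1 ∧ p' = q + 2) ∨ (p = q + 2 ∧ p' = q + 1) := by
    clear * - hp hp' hpp'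
    revert p p' q
    decide
  rw [Vvan, Vvan, Vvan, ThreeComponentCurve.vanishing_compl (g.invertible a) q, ← inf_inf_distrib_left]
  rcases h with ⟨rfl, rfl⟩ | ⟨rfl, rfl⟩
  · rfl
  · rw [inf_comm (C.vanishing _ (C.component (q + 2)))]

lemma Distributive.sup_inf_sup_le {g : LimitLinearSeries C d r} {a : Multidegree d}
    (h : g.Distributive a) {p p' q : Fin 3} (hp : p ≠ q) (hp' : p' ≠ q) (hpp' : p ≠ p') :
    (g.Vvan a (C.component p) ⊔ g.Vvan a (C.component q)) ⊓
      (g.Vvan a (C.component p') ⊔ g.Vvan a (C.component q)) ≤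
    (g.Vvan a (C.component p) ⊓ g.Vvan a (C.component p')) ⊔ g.Vvan a (C.component q) := by
  wlog hlt : p < p' generalizing p p'
  · rw [inf_comm, inf_comm (g.Vvan a (C.component p))]
    exact this hp' hp hpp'.symm (hpp'.symm.lt_of_le (not_lt.1 hlt))
  have h1 := le_of_eq h
  have hcases : (q = 0 ∧ p = 1 ∧ p' = 2) ∨ (q = 1 ∧ p = 0 ∧ p' = 2) ∨ (q = 2 ∧ p = 0 ∧ p' = 1) := by
    clear * - hp hp' hpp' hlt
    revert p p' q
    decide
  rcases hcases with ⟨rfl, rfl, rfl⟩ | ⟨rfl, rfl, rfl⟩ | ⟨rfl, rfl, rfl⟩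
  · exact sup_inf_sup_le_of_distrib h1
  · exact sup_inf_sup_le_of_distrib_left h1
  · apply sup_inf_sup_le_of_distrib_left
    rwa [sup_comm, sup_comm (_ ⊓ _)]

/-- Compatible bases exist for `X_q`, provided that the multidegrees with an arrow to a given one
are arranged as in the grid of multidegrees. -/
lemma exists_complement_basis (hexact : g.IsExact) (hdist : ∀ a, g.Distributive a)
    {p p' q : Fin 3} (hp : p ≠ q) (hp' : p' ≠ q) (hpp' : p ≠ p')
    (rank : Multidegree d → ℕ) (hrank : ∀ a b : Multidegree d, IsLink q b a → rank b < rank a)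
    (hone : ∀ a : Multidegree d, (∀ b, ¬ Step p b a) ∨ (∀ b, ¬ Step p' b a) →
      (∀ b, ¬ IsLink q b a) ∨ ∃ b, IsLink q b a ∧ ∀ c, IsLink q c a → c = b ∨
        (Step p b a ∧ Step p' c b ∧ Step q a c) ∨ (Step p' b a ∧ Step p c b ∧ Step q a c))
    (htwo : ∀ a b c : Multidegree d, Step p b a → Step p' c a →
      (∃ e, Step q a e ∧ Step p' e b ∧ Step p e c) ∨ ((∀ e, ¬ Step q a e) ∧
        g.Vvan a (C.component p) ⊓ g.Vvan a (C.component p') = ⊥)) :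
    ∃ (W : ∀ a, Submodule k (C.H0 (g.L a))) (β : ∀ a, Set (C.H0 (g.L a))),
      g.IsComplementBasis q W β ∧ ∀ a b, IsLink q b a → g.link b a '' β b ⊆ β a := by
  obtain ⟨β, hβ, hlink⟩ := exists_linked_bases g.V (fun a ↦ g.Vvan a (C.component q)) g.link
    (IsLink q) rank hrank (fun a b h ↦ g.map_le_of_isLink h)
    (fun a b h s hs h' ↦ g.mem_Vvan_of_isLink h hs h') (fun a b h ↦ g.map_Vvan_le_of_isLink h) (by
      intro a
      by_cases hno : (∀ b, ¬ Step p b a) ∨ (∀ b, ¬ Step p' b a)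
      · refine (hone a hno).imp id fun ⟨b, hb, h⟩ ↦ .inl ⟨b, hb, fun c hc ↦ ?_⟩
        rcases h c hc with h | ⟨h1, h2, h3⟩ | ⟨h1, h2, h3⟩
        · exact .inl h
        · exact .inr (g.through_of_step hp' hpp' h1 h2 h3)
        · exact .inr (g.through_of_step hp hpp'.symm h1 h2 h3)
      push Not at hno
      obtain ⟨⟨b, hb⟩, ⟨c, hc⟩⟩ := hno
      have hinf := (hdist a).sup_inf_sup_le hp hp' hpp'
      -- Exactness turns the subspaces in the distributive law into images of links.
      rw [← (hexact p b a hb).1, ← (hexact p' c a hc).1] at hinf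
      refine .inr (.inr ⟨b, c, .inl ⟨p, hp, hb⟩, .inl ⟨p', hp', hc⟩, ?_, ?_⟩)
      · rintro e (⟨p'', hp'', he⟩ | he)
        · have : p'' = p ∨ p'' = p' := by
            clear * - hp hp' hpp' hp''
            revert p p' q p''
            decide
          rcases this with rfl | rfl
          · exact .inl (he.left_unique hb)
          · exact .inr (.inl (he.left_unique hc))
        · rcases htwo a b c hb hc with ⟨e', h1, h2, -⟩ | ⟨h, -⟩
          · rw [he.right_unique h1]
            exact .inr (.inr (g.through_of_step hp' hpp' hb h2 h1))
          · exact (h e he).elim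
      · rcases htwo a b c hb hc with ⟨e, h1, h2, h3⟩ | ⟨-, h⟩
        · refine .inr ⟨e, g.through_of_step hp' hpp' hb h2 h1,
            g.through_of_step hp hpp'.symm hc h3 h1, ?_⟩
          rw [(hexact q a e h1).2, ← g.Vvan_inf hp hp' hpp', ← (hexact p b a hb).1,
            ← (hexact p' c a hc).1]
          exact hinf
        · rw [← (hexact p b a hb).1, ← (hexact p' c a hc).1] at h
          rw [h, bot_sup_eq] at hinf
          exact .inl hinf)
  refine ⟨fun a ↦ Submodule.span k (β a), β, fun a ↦ ⟨?_, rfl, ?_, ?_⟩, hlink⟩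
  · exact (hβ a).linearIndepOn.of_comp (v := id)
  · exact le_antisymm (sup_le (Submodule.span_le.2 (hβ a).subset) inf_le_left) (hβ a).le_sup
  -- Independence modulo a subspace makes the span disjoint from it.
  · have := Submodule.range_ker_disjoint (f := (g.Vvan a (C.component q)).mkQ)
      (v := ((↑) : β a → C.H0 (g.L a))) (hβ a).linearIndepOn
    rwa [Subtype.range_coe, Submodule.ker_mkQ] at this

end LimitLinearSeries

end LimitLinear

end

/-! ### The three components: ranks and edges of the grid -/

open LimitLinear

theorem mainTheorem8 {k : Type u} [Field k] [IsAlgClosed k]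
    (C : LimitLinear.ThreeComponentCurve k) (d r : ℕ)
    (g : LimitLinear.LimitLinearSeries C d r)
    (hexact : g.IsExact) (hdist : ∀ a, g.Distributive a) :
    (∃ (W : ∀ a, Submodule k (C.H0 (g.L a))) (β : ∀ a, Set (C.H0 (g.L a))),
      g.IsComplementBasis 0 W β ∧
      (∀ (i l : ℕ) (h : i + l ≤ d) (h' : i + (l + 1) ≤ d),
        g.link ⟨i, l + 1, h'⟩ ⟨i, l, h⟩ '' β ⟨i, l + 1, h'⟩ ⊆ β ⟨i, l, h⟩) ∧
      (∀ (i l : ℕ) (h : i + l ≤ d) (h' : (i + 1) + (l + 1) ≤ d),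
        g.link ⟨i, l, h⟩ ⟨i + 1, l + 1, h'⟩ '' β ⟨i, l, h⟩ ⊆ β ⟨i + 1, l + 1, h'⟩) ∧
      (∀ (i l : ℕ) (h : i + l ≤ d) (h' : (i + 1) + l ≤ d),
        g.link ⟨i, l, h⟩ ⟨i + 1, l, h'⟩ '' β ⟨i, l, h⟩ ⊆ β ⟨i + 1, l, h'⟩)) ∧
    (∃ (W : ∀ a, Submodule k (C.H0 (g.L a))) (β : ∀ a, Set (C.H0 (g.L a))),
      g.IsComplementBasis 1 W β ∧
      (∀ (i l : ℕ) (h : i + l ≤ d) (h' : i + (l + 1) ≤ d),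
        g.link ⟨i, l + 1, h'⟩ ⟨i, l, h⟩ '' β ⟨i, l + 1, h'⟩ ⊆ β ⟨i, l, h⟩) ∧
      (∀ (i l : ℕ) (h : i + l ≤ d) (h' : (i + 1) + l ≤ d),
        g.link ⟨i + 1, l, h'⟩ ⟨i, l, h⟩ '' β ⟨i + 1, l, h'⟩ ⊆ β ⟨i, l, h⟩) ∧
      (∀ (i l : ℕ) (h : i + l ≤ d) (h' : (i + 1) + (l + 1) ≤ d),
        g.link ⟨i + 1, l + 1, h'⟩ ⟨i, l, h⟩ '' β ⟨i + 1, l + 1, h'⟩ ⊆ β ⟨i, l, h⟩)) ∧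
    (∃ (W : ∀ a, Submodule k (C.H0 (g.L a))) (β : ∀ a, Set (C.H0 (g.L a))),
      g.IsComplementBasis 2 W β ∧
      (∀ (i l : ℕ) (h : i + l ≤ d) (h' : (i + 1) + l ≤ d),
        g.link ⟨i + 1, l, h'⟩ ⟨i, l, h⟩ '' β ⟨i + 1, l, h'⟩ ⊆ β ⟨i, l, h⟩) ∧
      (∀ (i l : ℕ) (h : i + l ≤ d) (h' : (i + 1) + (l + 1) ≤ d),
        g.link ⟨i, l, h⟩ ⟨i + 1, l + 1, h'⟩ '' β ⟨i, l, h⟩ ⊆ β ⟨i + 1, l + 1, h'⟩) ∧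
      (∀ (i l : ℕ) (h : i + l ≤ d) (h' : i + (l + 1) ≤ d),
        g.link ⟨i, l, h⟩ ⟨i, l + 1, h'⟩ '' β ⟨i, l, h⟩ ⊆ β ⟨i, l + 1, h'⟩)) := by
  have hlink0 : ∀ a b : Multidegree d, IsLink 0 b a ↔
      (a.i = b.i + 1 ∧ a.l = b.l + 1) ∨ (b.i = a.i ∧ b.l = a.l + 1) ∨
        (a.i = b.i + 1 ∧ a.l = b.l) := by
    intro a b
    simp [IsLink, Fin.exists_fin_succ, step_zero_iff, step_one_iff, step_two_iff, or_assoc]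
  have hlink1 : ∀ a b : Multidegree d, IsLink 1 b a ↔
      (b.i = a.i + 1 ∧ b.l = a.l) ∨ (b.i = a.i ∧ b.l = a.l + 1) ∨
        (b.i = a.i + 1 ∧ b.l = a.l + 1) := by
    intro a b
    simp [IsLink, Fin.exists_fin_succ, step_zero_iff, step_one_iff, step_two_iff, or_assoc]
  have hlink2 : ∀ a b : Multidegree d, IsLink 2 b a ↔
      (b.i = a.i + 1 ∧ b.l = a.l) ∨ (a.i = b.i + 1 ∧ a.l = b.l + 1) ∨
        (a.i = b.i ∧ a.l = b.l + 1) := by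
    intro a b
    simp [IsLink, Fin.exists_fin_succ, step_zero_iff, step_one_iff, step_two_iff, or_assoc]
  refine ⟨?_, ?_, ?_⟩
  -- The arrows raise both `i` and `l`, lower `l`, or raise `i`; this rank grows by 1, 1 and 2
  -- respectively.
  · obtain ⟨W, β, hβ, h⟩ := g.exists_complement_basis hexact hdist (p := 1) (p' := 2) (q := 0)
      (by decide) (by decide) (by decide) (fun a ↦ 2 * a.i + (d - a.l))
      (by
        intro a b h
        rw [hlink0] at h
        have := a.le
        have := b.le
        omega)
      (by
        intro a hno
        simp only [hlink0, step_one_iff, step_two_iff, step_zero_iff, Multidegree.ext_iff] at hno ⊢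
        have ha := a.le
        have hno' : a.i = 0 ∨ a.l = 0 ∨ d < a.i + a.l + 1 := by
          by_contra! hc
          rcases hno with hno | hno
          · exact hno ⟨a.i - 1, a.l - 1, by omega⟩ ⟨by dsimp only; omega, by dsimp only; omega⟩
          · exact hno ⟨a.i, a.l + 1, by omega⟩ ⟨rfl, rfl⟩
        by_cases h1 : a.i = 0 ∨ a.l = 0
        · by_cases h2 : a.i + a.l + 1 ≤ d
          · refine .inr ⟨⟨a.i, a.l + 1, h2⟩, by simp, fun c hc ↦ ?_⟩
            dsimp only
            omega
          · by_cases h3 : a.i = 0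
            · refine .inl fun b ↦ ?_
              have := b.le
              omega
            -- At the corner `l = 0`, `i = d > 0` the reversed step is the only arrow.
            · refine .inr ⟨⟨a.i - 1, a.l, by omega⟩, by dsimp only; omega, fun c hc ↦ ?_⟩
              have := c.le
              dsimp only
              omega
        · refine .inr ⟨⟨a.i - 1, a.l - 1, by omega⟩, by dsimp only; omega, fun c hc ↦ ?_⟩
          have := c.le
          dsimp only
          omega)
      (by
        intro a b c hb hc
        rw [step_one_iff] at hb
        rw [step_two_iff] at hc
        have := c.le
        -- The existence of `b` forces `i ≥ 1`, so the third predecessor is always in the grid.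
        refine .inl ⟨⟨a.i - 1, a.l, by omega⟩, ?_⟩
        simp only [step_zero_iff, step_one_iff, step_two_iff, and_true]
        omega)
    refine ⟨W, β, hβ, fun i l _ _ ↦ h _ _ ?_, fun i l _ _ ↦ h _ _ ?_, fun i l _ _ ↦ h _ _ ?_⟩ <;>
      simp [hlink0]
  · obtain ⟨W, β, hβ, h⟩ := g.exists_complement_basis hexact hdist (p := 0) (p' := 2) (q := 1)
      (by decide) (by decide) (by decide) (fun a ↦ 2 * d - a.i - a.l)
      (by
        intro a b h
        rw [hlink1] at h
        have := a.le
        have := b.le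
        omega)
      (by
        intro a hno
        simp only [hlink1, step_one_iff, step_two_iff, step_zero_iff] at hno ⊢
        -- Both steps need exactly `i + l < d`, so without one of them no arrow enters at all.
        refine .inl fun b hb ↦ ?_
        have := b.le
        rcases hno with hno | hno
        · exact hno ⟨a.i + 1, a.l, by omega⟩ ⟨rfl, rfl⟩
        · exact hno ⟨a.i, a.l + 1, by omega⟩ ⟨rfl, rfl⟩)
      (by
        intro a b c hb hc
        rw [step_zero_iff] at hb
        rw [step_two_iff] at hc
        simp only [step_zero_iff, step_one_iff, step_two_iff]
        by_cases h : a.i + 1 + (a.l + 1) ≤ d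
        · refine .inl ⟨⟨a.i + 1, a.l + 1, h⟩, ?_⟩
          dsimp only
          omega
        -- The third predecessor leaves the grid exactly when the degree on `X_2` is below two.
        · refine .inr ⟨fun e ↦ ?_, ?_⟩
          · have := e.le
            omega
          · rw [eq_bot_iff]
            intro s hs
            refine ThreeComponentCurve.eq_zero_of_mem_vanishing (g.invertible a) ?_
              (g.multidegree a 1) hs.1.2 hs.2.2
            simp [Multidegree.deg]
            omega)
    refine ⟨W, β, hβ, fun i l _ _ ↦ h _ _ ?_, fun i l _ _ ↦ h _ _ ?_, fun i l _ _ ↦ h _ _ ?_⟩ <;>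
      simp [hlink1]
  · obtain ⟨W, β, hβ, h⟩ := g.exists_complement_basis hexact hdist (p := 0) (p' := 1) (q := 2)
      (by decide) (by decide) (by decide) (fun a ↦ 2 * a.l + (d - a.i))
      (by
        intro a b h
        rw [hlink2] at h
        have := a.le
        have := b.le
        omega)
      (by
        intro a hno
        simp only [hlink2, step_one_iff, step_two_iff, step_zero_iff, Multidegree.ext_iff] at hno ⊢
        have ha := a.le
        have hno' : a.i = 0 ∨ a.l = 0 ∨ d < a.i + a.l + 1 := by
          by_contra! hc
          rcases hno with hno | hno
          · exact hno ⟨a.i + 1, a.l, by omega⟩ ⟨rfl, rfl⟩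
          · exact hno ⟨a.i - 1, a.l - 1, by omega⟩ ⟨by dsimp only; omega, by dsimp only; omega⟩
        by_cases h1 : a.i = 0 ∨ a.l = 0
        · by_cases h2 : a.i + a.l + 1 ≤ d
          · refine .inr ⟨⟨a.i + 1, a.l, by omega⟩, by simp, fun c hc ↦ ?_⟩
            dsimp only
            omega
          · by_cases h3 : a.l = 0
            · refine .inl fun b ↦ ?_
              have := b.le
              omega
            · refine .inr ⟨⟨a.i, a.l - 1, by omega⟩, by dsimp only; omega, fun c hc ↦ ?_⟩
              have := c.le
              dsimp only
              omega
        · refine .inr ⟨⟨a.i - 1, a.l - 1, by omega⟩, by dsimp only; omega, fun c hc ↦ ?_⟩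
          have := c.le
          dsimp only
          omega)
      (by
        intro a b c hb hc
        rw [step_zero_iff] at hb
        rw [step_one_iff] at hc
        have := b.le
        refine .inl ⟨⟨a.i, a.l - 1, by omega⟩, ?_⟩
        simp only [step_zero_iff, step_one_iff, step_two_iff, true_and]
        omega)
    refine ⟨W, β, hβ, fun i l _ _ ↦ h _ _ ?_, fun i l _ _ ↦ h _ _ ?_, fun i l _ _ ↦ h _ _ ?_⟩ <;>
      simp [hlink2]
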